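/- Let $K$ be a field of characteristic $0$ and $\mathcal C$ a set. Let $\operatorname{Alg}(\mathcal C)$ be the free non-associative, non-commutative, non-unital $K$-algebra on $\mathcal C$, with product $\rhd$, and put $$\operatorname{ass}(x,y,z)=x\rhd(y\rhd z)-(x\rhd y)\rhd z,\qquad [x,y,z]=\operatorname{ass}(x,y,z)-\operatorname{ass}(y,x,z).$$ Let $\mathcal I$ be the two-sided ideal generated by all elements $[x,y,z]+[y,z,x]+[z,x,y]$ and $w\rhd[x,y,z]-[w\rhd x,y,z]-[x,w\rhd y,z]-[x,y,w\rhd z]$, and let $\operatorname{LAT}(\mathcal C)=\operatorname{Alg}(\mathcal C)/\mathcal I$ be the free Lie admissible triple algebra. A word $x_1\cdots x_k$ of elements of $\operatorname{Alg}(\mathcal C)$ acts on $r\in\operatorname{Alg}(\mathcal C)$ by the following rule: the empty word acts as the identity, and $$(x\cdot u_1\cdots u_k)\rhd r=x\rhd\big((u_1\cdots u_k)\rhd r\big)-\sum_{i=1}^k\big(u_1\cdots (x\rhd u_i)\cdots u_k\big)\rhd r .$$ Put $\mathfrak s(x_1\cdots x_k)=\frac1{k!}\sum_{\sigma\in S_k}x_{\sigma(1)}\cdots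 x_{\sigma(k)}$. For a set $X$ let $\operatorname{Mag}_3(X)$ be the set of formal iterated triple brackets of elements of $X$. Given a weight $\omega\colon X\to\{1,2,3,\dots\}$ (for instance $\omega=1$), let $|\cdot|$ be the grading of $\operatorname{Mag}_3(X)$ with $|x|=\omega(x)$ for $x\in X$ and $|[a,b,c]|=|a|+|b|+|c|$. Let $<$ be any total order on $\operatorname{Mag}_3(X)$ such that $|u|<|v|$ implies $u<v$. For $S\subset X$ the Hall triple set $H(S)\subset\operatorname{Mag}_3(S)$ is defined recursively by: $S\subset H(S)$, and $[u,v,w]\in H(S)$ if and only if $u,v,w\in H(S)$, $u>v\le w$, and either $u\in S$ or $u=[a,b,c]$ with $c\le v$. Fix such a weight and order for $X=\operatorname{Alg}(\mathcal C)$. Evaluating formal brackets by the triple bracket of $\operatorname{Alg}(\mathcal C)$ turns $H(S)$ into a subset of $\operatorname{Alg}(\mathcal C)$, also written $H(S)$. Theorem. There is a smallest subset $\mathcal B\subset\operatorname{Alg}(\mathcal C)$ such that $$\mathcal B=H(S),\qquad S=\{\mathfrak s(b_1\cdots b_k)\rhd c\mid b_1,\dots,b_k\in\mathcal B,\ c\in\mathcal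 C,\ k\ge 0\},$$ and the classes of its elements (distinct elements having distinct classes) form a basis of $\operatorname{LAT}(\mathcal C)$. Moreover distinct formal brackets in $H(S)$ are distinct elements of $\operatorname{Alg}(\mathcal C)$, and $\mathfrak s(b_1\cdots b_k)\rhd c=\mathfrak s(b'_1\cdots b'_l)\rhd c'$ with $b_i,b'_j\in\mathcal B$, $c,c'\in\mathcal C$ holds only if $c=c'$, $k=l$ and $(b'_j)$ is a permutation of $(b_i)$. So, without repetition, the basis consists of the non-planar trees with internal nodes coloured by $\mathcal C$ and leaves that are colours or triple brackets from $H(S)$, together with the triple brackets from $H(S)$. -/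

import Mathlib

noncomputable section

namespace LieTriple

/-- The free (non-associative, non-commutative, non-unital) `K`-algebra `Alg(C)` on the set of
colours `C`. Its product `x * y` is the triangle product `x ▷ y`. -/
abbrev Alg (K C : Type*) [Field K] : Type _ := FreeNonUnitalNonAssocAlgebra K C

/-- The colour `c ∈ C` as a generator of `Alg(C)`. -/
abbrev colour (K : Type*) {C : Type*} [Field K] (c : C) : Alg K C :=
  FreeNonUnitalNonAssocAlgebra.of K c

section Product

variable {A : Type*} [NonUnitalNonAssocRing A]

/-- The negative associator `ass(x, y, z) = x ▷ (y ▷ z) - (x ▷ y) ▷ z`. -/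
def ass (x y z : A) : A := x * (y * z) - (x * y) * z

/-- The triple bracket `[x, y, z] = ass(x, y, z) - ass(y, x, z)`. -/
def triple (x y z : A) : A := ass x y z - ass y x z

/-- The action `(x₁ ⋯ xₖ) ▷ r` of a word on an element of the algebra, as in the D-algebra of `A`:
the empty word acts as the identity, and
`(x · u) ▷ r = x ▷ (u ▷ r) - (x ▷ u) ▷ r` for a letter `x` and a word `u`, where `x ▷ u` is given
by the Leibniz rule `x ▷ (u₁ ⋯ uₖ) = ∑ i, u₁ ⋯ (x ▷ uᵢ) ⋯ uₖ`. -/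
def graft : (k : ℕ) → (Fin k → A) → A → A
  | 0, _, r => r
  | k + 1, x, r =>
      x 0 * graft k (fun i => x i.succ) r
        - ∑ i : Fin k,
            graft k (Function.update (fun j : Fin k => x j.succ) i (x 0 * x i.succ)) r

end Product

/-- The left-hand sides of the two identities of a Lie admissible triple algebra, evaluated at all
elements of `Alg(C)`. -/
def latRelations (K C : Type*) [Field K] : Set (Alg K C) :=
  {a | ∃ x y z : Alg K C, a = triple x y z + triple y z x + triple z x y} ∪
  {a | ∃ w x y z : Alg K C,
    a = w * triple x y z - triple (w * x) y z - triple x (w * y) z - triple x y (w * z)}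

/-- The two-sided ideal `I` of the `K`-algebra `Alg(C)` generated by the relations: the smallest
linear subspace which contains them and absorbs left and right multiplication. -/
def latIdeal (K C : Type*) [Field K] : Submodule K (Alg K C) :=
  sInf {J | latRelations K C ⊆ J ∧ ∀ a : Alg K C, ∀ x ∈ J, a * x ∈ J ∧ x * a ∈ J}

theorem latIdeal_mul_left {K C : Type*} [Field K] (a : Alg K C) {x : Alg K C}
    (hx : x ∈ latIdeal K C) : a * x ∈ latIdeal K C := by
  simp only [latIdeal, Submodule.mem_sInf, Set.mem_ofPred_eq] at hx ⊢
  exact fun J hJ => (hJ.2 a x (hx J hJ)).1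

theorem latIdeal_mul_right {K C : Type*} [Field K] (a : Alg K C) {x : Alg K C}
    (hx : x ∈ latIdeal K C) : x * a ∈ latIdeal K C := by
  simp only [latIdeal, Submodule.mem_sInf, Set.mem_ofPred_eq] at hx ⊢
  exact fun J hJ => (hJ.2 a x (hx J hJ)).2

/-- The free Lie admissible triple algebra `LAT(C) = Alg(C) / I`. -/
abbrev LAT (K C : Type*) [Field K] : Type _ := Alg K C ⧸ latIdeal K C

/-- The product of `LAT(C)`, induced by that of `Alg(C)`. -/
instance latMul (K C : Type*) [Field K] : Mul (LAT K C) where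
  mul := Quotient.map₂ (fun x y => x * y) (by
    intro a a' ha b b' hb
    replace ha := (Submodule.quotientRel_def _).mp ha
    replace hb := (Submodule.quotientRel_def _).mp hb
    refine (Submodule.quotientRel_def _).mpr ?_
    have h : a * b - a' * b' = (a - a') * b + a' * (b - b') := by
      rw [sub_mul, mul_sub]; abel
    rw [h]
    exact add_mem (latIdeal_mul_right _ ha) (latIdeal_mul_left _ hb))

/-- The triple magma `Mag₃(X)`: formal iterated triple brackets of elements of `X`, i.e. planar
ternary trees with leaves in `X`. -/
inductive TripleMagma (X : Type*) : Type _
  | leaf : X → TripleMagma X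
  | bracket : TripleMagma X → TripleMagma X → TripleMagma X → TripleMagma X

namespace TripleMagma

/-- The grading of `Mag₃(X)` for a weight `ω` on the letters: the grade of a letter is its weight,
and the grade of `[a, b, c]` is the sum of the grades of `a`, `b` and `c`. For `ω = 1` it is the
number of letters. -/
def grade {X : Type*} (ω : X → ℕ) : TripleMagma X → ℕ
  | leaf x => ω x
  | bracket a b c => grade ω a + grade ω b + grade ω c

/-- Evaluation of formal triple brackets in an algebra. -/
def eval {A : Type*} [NonUnitalNonAssocRing A] : TripleMagma A → A
  | leaf x => x
  | bracket a b c => triple (eval a) (eval b) (eval c)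

/-- `u` is a letter, or `u = [a, b, c]` with `c ≤ v`. -/
def LastLE {X : Type*} [LE (TripleMagma X)] : TripleMagma X → TripleMagma X → Prop
  | leaf _, _ => True
  | bracket _ _ c, v => c ≤ v

/-- Membership in the Hall triple set `H(S) ⊆ Mag₃(S)` of a set of letters `S`, for a given total
order on the formal triple brackets: every letter of `S` is in `H(S)`, and `[u, v, w] ∈ H(S)` if
and only if `u, v, w ∈ H(S)`, `u > v ≤ w`, and `u` is a letter or `u = [a, b, c]` with
`c ≤ v`. -/
inductive IsHall {X : Type*} [LinearOrder (TripleMagma X)] (S : Set X) : TripleMagma X → Prop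
  | leaf {s : X} : s ∈ S → IsHall S (leaf s)
  | bracket {u v w : TripleMagma X} : IsHall S u → IsHall S v → IsHall S w →
      v < u → v ≤ w → LastLE u v → IsHall S (bracket u v w)

end TripleMagma

/-- The symmetrised word `𝔰(b₁ ⋯ bₖ) = (1/k!) ∑ σ, b_σ(1) ⋯ b_σ(k)` acting on `r`, that is
`𝔰(b₁ ⋯ bₖ) ▷ r`. -/
def symGraft {K C : Type*} [Field K] {k : ℕ} (b : Fin k → Alg K C) (r : Alg K C) : Alg K C :=
  ((k.factorial : K)⁻¹) • ∑ σ : Equiv.Perm (Fin k), graft k (fun i => b (σ i)) r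

/-- The set `{𝔰(b₁ ⋯ bₖ) ▷ c | b₁, …, bₖ ∈ B, c ∈ C, k ≥ 0}` of symmetrised trees. -/
def symTrees {K C : Type*} [Field K] (B : Set (Alg K C)) : Set (Alg K C) :=
  {a | ∃ (k : ℕ) (b : Fin k → Alg K C) (c : C), (∀ i, b i ∈ B) ∧ a = symGraft b (colour K c)}

/-- The Hall triple set `H(S)`, as a set of formal triple brackets of elements of `S`. -/
def hallSet {K C : Type*} [Field K] [LinearOrder (TripleMagma (Alg K C))]
    (S : Set (Alg K C)) : Set (TripleMagma (Alg K C)) :=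
  {h | h.IsHall S}

end LieTriple

end

/-! The set `B` is the least fixed point `hallTriples` of the monotone operator `hallStep`. What
remains is that its classes span `LAT(C)`, that they are independent, and that brackets and trees
label its elements faithfully.

Spanning. In `LAT(C)` left multiplications are derivations of the triple bracket. Hall rewriting
(`triple_mem_hallSpan`) shows that the span W of the Hall brackets is closed under triple brackets.
Exchanging neighbouring letters of a word changes its action only by triple brackets involving
shorter words (`wordAct_swap`), so modulo W a word with letters in W acts on a colour as its
symmetrisation does (`wordAct_mem`). Since w ▷ (u ▷ c) is (wu) ▷ c plus a Leibniz sum, W is closed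
under the product (`mul_mem_hallSubspace`); it contains the colours, hence is everything.

Independence. The two identities hold for the canonical connection of a symmetric space, so a model
is built from a formal one. In the free associative algebra on the letters X = `Alg(C)`, let θ
change the sign of the letters; the odd Lie-like elements with ⁅w, ⁅u, v⁆⁆ play the tangent space at
the base point. Vector fields are formal functions on the group with odd values, equivariant for the
even part (`fieldAlgebra`); they satisfy both identities (`field_jacobi`, `field_derivation`). At
the base point the triple bracket becomes ⁅w, ⁅u, v⁆⁆ (`baseValue_triple`), and a word acts on r by
evaluating r at the product of the values of its letters (`baseValue_wordAct`).

A field may be given arbitrary odd values on the symmetrised products of Hall polynomials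
(`exists_isField`). Hence the images of the colours can be chosen so that each symmetrised tree
built from `B` has as base value the letter which is that very tree. Each Hall bracket then has its
Hall polynomial as base value (`exists_hall_model`), and these are independent by straightening
(`linearIndependent_hallPoly`). Changing the prescribed value of a single tree separates it from all
others (`symGraft_injective`). -/

noncomputable section

namespace LieTriple

open TripleMagma

/-! ### Independence of the Hall polynomials by straightening -/

section HallIndependence

variable (K : Type*) {X : Type*} [Field K]

/-- The Lie polynomial of a formal triple bracket in the free associative algebra, where the triple
bracket of the odd part is `[u, v, w] = ⁅w, ⁅u, v⁆⁆`. -/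
def hallPoly : TripleMagma X → FreeAlgebra K X
  | leaf x => FreeAlgebra.ι K x
  | bracket u v w => ⁅hallPoly w, ⁅hallPoly u, hallPoly v⁆⁆

/-- Prepending a tree, on formal linear combinations of lists of trees. -/
def consLin (t : TripleMagma X) :
    (List (TripleMagma X) →₀ K) →ₗ[K] (List (TripleMagma X) →₀ K) :=
  Finsupp.lmapDomain K K (List.cons t)

variable [LinearOrder (TripleMagma X)]

/-- Straightening: the action of a tree `o`, and of a pair of trees `(u, v)` standing for the
commutator `⁅u, v⁆`, on an increasing list of trees. -/
def straighten : List (TripleMagma X) →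
    (TripleMagma X → (List (TripleMagma X) →₀ K)) ×
      (TripleMagma X → TripleMagma X → (List (TripleMagma X) →₀ K))
  -- Commutators kill the empty list: the model is the module induced from the trivial
  -- representation of the even part, with increasing products of Hall trees as basis.
  | [] => (fun o => Finsupp.single [o] 1, fun _ _ => 0)
  -- The rules are o a = a o + ⁅o, a⁆ for o > a, and ⁅u, v⁆ a = a ⁅u, v⁆ - [u, v, a], because [u, v,
  -- a] stands for ⁅a, ⁅u, v⁆⁆.
  | a :: h =>
    (fun o => if o ≤ a then Finsupp.single (o :: a :: h) 1
      else consLin K a ((straighten h).1 o) + (straighten h).2 o a,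
     fun u v => consLin K a ((straighten h).2 u v) - (straighten h).1 (bracket u v a))

/-- The representation of the free associative algebra on lists of trees in which the letters act
by straightening. -/
def listRep : FreeAlgebra K X →ₐ[K] Module.End K (List (TripleMagma X) →₀ K) :=
  FreeAlgebra.lift K fun x =>
    Finsupp.lift (List (TripleMagma X) →₀ K) K _ fun h => (straighten K h).1 (leaf x)

/-- Increasing lists of Hall trees that are at least `w`. -/
def sortedHall (w : TripleMagma X) : Set (List (TripleMagma X)) :=
  {h | (∀ t ∈ h, IsHall Set.univ t ∧ w ≤ t) ∧ h.Pairwise (· ≤ ·)}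

variable {K}

omit [LinearOrder (TripleMagma X)] in
theorem consLin_single (t : TripleMagma X) (h : List (TripleMagma X)) :
    consLin K t (Finsupp.single h 1) = Finsupp.single (t :: h) 1 := by
  simp [consLin, Finsupp.lmapDomain_apply, Finsupp.mapDomain_single]

theorem consLin_mem {w t : TripleMagma X} (ht : IsHall Set.univ t) (hw : w ≤ t)
    {f : List (TripleMagma X) →₀ K} (hf : f ∈ Finsupp.supported K K (sortedHall t)) :
    consLin K t f ∈ Finsupp.supported K K (sortedHall w) := by
  rw [Finsupp.supported_eq_span_single] at hf
  induction hf using Submodule.span_induction with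
  | mem x hx =>
    obtain ⟨h, hh, rfl⟩ := hx
    simp only [consLin_single]
    refine Finsupp.single_mem_supported K _ ⟨?_, ?_⟩
    · intro s hs
      rcases List.mem_cons.1 hs with rfl | hs
      · exact ⟨ht, hw⟩
      · exact ⟨(hh.1 s hs).1, hw.trans (hh.1 s hs).2⟩
    · exact List.pairwise_cons.2 ⟨fun s hs => (hh.1 s hs).2, hh.2⟩
  | zero => simp
  | add x y _ _ hx hy => rw [map_add]; exact add_mem hx hy
  | smul a x _ hx => rw [map_smul]; exact Submodule.smul_mem _ _ hx

variable {ω : X → ℕ} (hω : ∀ s, 0 < ω s)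
  (hlt : ∀ u v : TripleMagma X, u.grade ω < v.grade ω → u < v)

omit [LinearOrder (TripleMagma X)] in
theorem grade_pos (hω : ∀ s, 0 < ω s) (t : TripleMagma X) : 0 < t.grade ω := by
  induction t with
  | leaf x => exact hω x
  | bracket a b c _ _ hc => simp only [TripleMagma.grade]; omega

include hω hlt

theorem lt_bracket_right (u v w : TripleMagma X) : w < bracket u v w := by
  apply hlt
  have := grade_pos hω u
  simp only [TripleMagma.grade]
  omega

theorem lastLE_of_le {v s : TripleMagma X} (h : v ≤ s) : LastLE v s := by
  cases v with
  | leaf x => trivial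
  | bracket a b c => exact ((lt_bracket_right hω hlt a b c).trans_le h).le

/-- The side conditions reproduce the Hall condition. When `o` passes a smaller `a`, the pair `(o,
a)` meets only entries t ≥ a, so each new bracket [o, a, t] is Hall; its last entry `t` is at most
every entry still to come, so it may be straightened in turn. -/
theorem straighten_mem (h : List (TripleMagma X)) :
    ∀ w, h ∈ sortedHall w →
      (∀ o, IsHall Set.univ o → w ≤ o → (∀ t ∈ h, LastLE o t) →
        (straighten K h).1 o ∈ Finsupp.supported K K (sortedHall w)) ∧
      (∀ u v, IsHall Set.univ u → IsHall Set.univ v → v < u → LastLE u v → (∀ t ∈ h, v ≤ t) →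
        (straighten K h).2 u v ∈ Finsupp.supported K K (sortedHall w)) := by
  induction h with
  | nil =>
    intro w _
    refine ⟨fun o ho hw _ => Finsupp.single_mem_supported K _ ⟨?_, by simp⟩, fun u v _ _ _ _ _ => ?_⟩
    · simpa using ⟨ho, hw⟩
    · exact Submodule.zero_mem _
  | cons a h ih =>
    intro w hh
    have ha := hh.1 a (by simp)
    have hp := List.pairwise_cons.1 hh.2
    have hw' : h ∈ sortedHall w := ⟨fun t ht => hh.1 t (by simp [ht]), hp.2⟩
    have ha' : h ∈ sortedHall a := ⟨fun t ht => ⟨(hh.1 t (by simp [ht])).1, hp.1 t ht⟩, hp.2⟩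
    refine ⟨fun o ho hw hl => ?_, fun u v hu hv huv hl hvt => ?_⟩
    · simp only [straighten]
      split_ifs with hoa
      · refine Finsupp.single_mem_supported K _ ⟨?_, ?_⟩
        · intro s hs
          rcases List.mem_cons.1 hs with rfl | hs
          · exact ⟨ho, hw⟩
          · exact hh.1 s hs
        · refine List.pairwise_cons.2 ⟨fun s hs => ?_, hh.2⟩
          rcases List.mem_cons.1 hs with rfl | hs
          · exact hoa
          · exact hoa.trans (hp.1 s hs)
      · push Not at hoa
        exact add_mem
          (consLin_mem ha.1 ha.2 ((ih a ha').1 o ho hoa.le fun t ht => hl t (by simp [ht])))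
          ((ih w hw').2 o a ho ha.1 hoa (hl a (by simp)) hp.1)
    · simp only [straighten]
      have hb : IsHall Set.univ (bracket u v a) := .bracket hu hv ha.1 huv (hvt a (by simp)) hl
      exact sub_mem
        (consLin_mem ha.1 ha.2 ((ih a ha').2 u v hu hv huv hl fun t ht => hvt t (by simp [ht])))
        ((ih w hw').1 _ hb (ha.2.trans (lt_bracket_right hω hlt u v a).le) hp.1)

omit hω hlt in
theorem straighten_of_le {v : TripleMagma X} {h : List (TripleMagma X)} (hv : ∀ t ∈ h, v ≤ t) :
    (straighten K h).1 v = Finsupp.single (v :: h) 1 := by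
  cases h with
  | nil => rfl
  | cons a h => simp [straighten, hv a (by simp)]

/-- Only letters act by straightening by definition. For a bracket the commutators are expanded on a
sorted list, where the smaller of two trees simply goes in front, and the rules of `straighten`
return the claim. -/
theorem listRep_hallPoly {t : TripleMagma X} (ht : IsHall Set.univ t) :
    ∀ h w, h ∈ sortedHall w → (∀ s ∈ h, LastLE t s) →
      listRep K (hallPoly K t) (Finsupp.single h 1) = (straighten K h).1 t := by
  induction ht with
  | leaf hx => intro h w _ _; simp [hallPoly, listRep]
  | @bracket u v w hu hv hw huv hvw hl ihu ihv ihw =>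
    -- On lists with all entries at least `t`, straightening `t` is prepending `t`.
    have hcons : ∀ t : TripleMagma X, IsHall Set.univ t → (∀ h w, h ∈ sortedHall w → (∀ s ∈ h, LastLE t s) →
        listRep K (hallPoly K t) (Finsupp.single h 1) = (straighten K h).1 t) →
        ∀ f ∈ Finsupp.supported K K (sortedHall t), listRep K (hallPoly K t) f = consLin K t f := by
      intro t ht iht f hf
      rw [Finsupp.supported_eq_span_single] at hf
      refine LinearMap.eqOn_span (f := listRep K (hallPoly K t)) (g := consLin K t) ?_ hf
      rintro _ ⟨h, hh, rfl⟩
      simp only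
      rw [iht h t hh fun s hs => lastLE_of_le hω hlt (hh.1 s hs).2, consLin_single,
        straighten_of_le fun s hs => (hh.1 s hs).2]
    have hE : ∀ h w', h ∈ sortedHall w' → (∀ s ∈ h, v ≤ s) →
        listRep K ⁅hallPoly K u, hallPoly K v⁆ (Finsupp.single h 1) = (straighten K h).2 u v := by
      intro h w' hh hvh
      have hhv : h ∈ sortedHall v := ⟨fun t ht => ⟨(hh.1 t ht).1, hvh t ht⟩, hh.2⟩
      have hul : ∀ s ∈ h, LastLE u s := by
        intro s hs
        cases u with
        | leaf x => trivial
        | bracket a b c => exact le_trans (show c ≤ v from hl) (hvh s hs)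
      have hvh' : v :: h ∈ sortedHall v := by
        refine ⟨fun s hs => ?_, List.pairwise_cons.2 ⟨hvh, hh.2⟩⟩
        rcases List.mem_cons.1 hs with rfl | hs
        · exact ⟨hv, le_rfl⟩
        · exact hhv.1 s hs
      -- As v < u, straightening `u` on `v :: h` is v · (u · h) plus the action of the pair, and v ·
      -- (u · h) cancels.
      rw [Ring.lie_def, map_sub, map_mul, map_mul, LinearMap.sub_apply, Module.End.mul_apply,
        Module.End.mul_apply, hcons v hv ihv _ (Finsupp.single_mem_supported K _ hhv),
        consLin_single, ihu _ v hvh' (by simpa using ⟨hl, hul⟩), ihu h v hhv hul,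
        hcons v hv ihv _ ((straighten_mem hω hlt h v hhv).1 u hu huv.le hul)]
      simp [straighten, huv.not_ge]
    intro h w' hh hwh
    have hwh' : ∀ s ∈ h, w ≤ s := hwh
    have hhw : h ∈ sortedHall w := ⟨fun t ht => ⟨(hh.1 t ht).1, hwh' t ht⟩, hh.2⟩
    have hwh'' : w :: h ∈ sortedHall w := by
      refine ⟨fun s hs => ?_, List.pairwise_cons.2 ⟨hwh', hh.2⟩⟩
      rcases List.mem_cons.1 hs with rfl | hs
      · exact ⟨hw, le_rfl⟩
      · exact hhw.1 s hs
    -- The action of the pair on `w :: h` contains minus the action of [u, v, w] on `h`; this is all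
    -- that survives in the commutator with `w`.
    rw [hallPoly, Ring.lie_def, map_sub, map_mul, map_mul, LinearMap.sub_apply,
      Module.End.mul_apply, Module.End.mul_apply,
      hcons w hw ihw _ (Finsupp.single_mem_supported K _ hhw), consLin_single,
      hE h w hhw fun s hs => hvw.trans (hwh' s hs),
      hE _ w hwh'' (by simpa using ⟨hvw, fun s hs => hvw.trans (hwh' s hs)⟩),
      hcons w hw ihw _ ((straighten_mem hω hlt h w hhw).2 u v hu hv huv hl
        fun s hs => hvw.trans (hwh' s hs))]
    simp [straighten]

/-- Applied to the empty list, the polynomials of distinct Hall trees give the distinct basis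
vectors `[t]`. -/
theorem linearIndependent_hallPoly :
    LinearIndependent K fun t : {t : TripleMagma X // IsHall Set.univ t} => hallPoly K t.1 := by
  have h1 : ∀ t : {t : TripleMagma X // IsHall Set.univ t},
      listRep K (hallPoly K t.1) (Finsupp.single [] 1) = Finsupp.single [t.1] 1 := fun t =>
    listRep_hallPoly hω hlt t.2 [] t.1 ⟨by simp, by simp⟩ (by simp)
  let ev : FreeAlgebra K X →ₗ[K] (List (TripleMagma X) →₀ K) :=
    (LinearMap.applyₗ (Finsupp.single [] 1)).comp (listRep K (X := X)).toLinearMap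
  refine LinearIndependent.of_comp ev ?_
  have h2 : (ev ∘ fun t : {t : TripleMagma X // IsHall Set.univ t} => hallPoly K t.1) =
      (fun l : List (TripleMagma X) => Finsupp.single l (1 : K)) ∘ fun t => [t.1] := by
    funext t
    exact h1 t
  rw [h2]
  refine (Finsupp.linearIndependent_single_one K _).comp _ ?_
  intro a b hab
  simpa [Subtype.ext_iff] using hab

end HallIndependence

end LieTriple

end

noncomputable section

namespace LieTriple

/-! ### Sums over decompositions of a multiset -/

section MultisetSums

variable {ι M : Type*} [AddCommMonoid M]

theorem sum_antidiagonal_cons (a : ι) (s : Multiset ι) (F : Multiset ι → Multiset ι → M) :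
    ((a ::ₘ s).antidiagonal.map fun p => F p.1 p.2).sum =
      (s.antidiagonal.map fun p => F p.1 (a ::ₘ p.2)).sum +
        (s.antidiagonal.map fun p => F (a ::ₘ p.1) p.2).sum := by
  simp [Multiset.antidiagonal_cons, Multiset.map_map]

theorem sum_antidiagonal_swap (s : Multiset ι) (F : Multiset ι → Multiset ι → M) :
    (s.antidiagonal.map fun p => F p.2 p.1).sum = (s.antidiagonal.map fun p => F p.1 p.2).sum := by
  conv_rhs => rw [← Multiset.map_swap_antidiagonal, Multiset.map_map]
  rfl

variable [DecidableEq ι]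

theorem cons_erase_of_mem {a i : ι} {s : Multiset ι} (hi : i ∈ s) :
    (a ::ₘ s).erase i = a ::ₘ s.erase i := by
  by_cases h : a = i
  · subst h; rw [Multiset.erase_cons_head, Multiset.cons_erase hi]
  · exact Multiset.erase_cons_tail _ h

theorem sum_map_erase_cons (a : ι) (s : Multiset ι) (F : ι → Multiset ι → M) :
    ((a ::ₘ s).map fun i => F i ((a ::ₘ s).erase i)).sum =
      F a s + (s.map fun i => F i (a ::ₘ s.erase i)).sum := by
  rw [Multiset.map_cons, Multiset.sum_cons, Multiset.erase_cons_head]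
  congr 2
  exact Multiset.map_congr rfl fun i hi => by rw [cons_erase_of_mem hi]

/-- Both sides run over the splittings of `s` into a marked element and two multisets. -/
theorem sum_erase_antidiagonal_left (s : Multiset ι) (F : ι → Multiset ι → Multiset ι → M) :
    (s.map fun i => ((s.erase i).antidiagonal.map fun p => F i p.1 p.2).sum).sum =
      (s.antidiagonal.map fun p => (p.1.map fun i => F i (p.1.erase i) p.2).sum).sum := by
  induction s using Multiset.induction_on generalizing F with
  | empty => simp
  | cons a s ih =>
    rw [sum_map_erase_cons a s fun i t => (t.antidiagonal.map fun p => F i p.1 p.2).sum,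
      sum_antidiagonal_cons a s fun p q => (p.map fun i => F i (p.erase i) q).sum]
    have h : ∀ p q : Multiset ι, ((a ::ₘ p).map fun i => F i ((a ::ₘ p).erase i) q).sum =
        F a p q + (p.map fun i => F i (a ::ₘ p.erase i) q).sum := fun p q =>
      sum_map_erase_cons a p fun i t => F i t q
    simp only [sum_antidiagonal_cons, h, Multiset.sum_map_add]
    rw [ih fun i p q => F i p (a ::ₘ q), ih fun i p q => F i (a ::ₘ p) q]
    abel

theorem sum_erase_antidiagonal_right (s : Multiset ι) (F : ι → Multiset ι → Multiset ι → M) :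
    (s.map fun i => ((s.erase i).antidiagonal.map fun p => F i p.1 p.2).sum).sum =
      (s.antidiagonal.map fun p => (p.2.map fun i => F i p.1 (p.2.erase i)).sum).sum := by
  rw [← sum_antidiagonal_swap s fun q p => (p.map fun i => F i q (p.erase i)).sum,
    ← sum_erase_antidiagonal_left s fun i p q => F i q p]
  exact congrArg _ (Multiset.map_congr rfl fun i _ =>
    (sum_antidiagonal_swap (s.erase i) fun p q => F i p q).symm)

theorem sum_erase_erase_comm (s : Multiset ι) (F : ι → ι → Multiset ι → M) :
    (s.map fun i => ((s.erase i).map fun j => F i j ((s.erase i).erase j)).sum).sum =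
      (s.map fun i => ((s.erase i).map fun j => F j i ((s.erase i).erase j)).sum).sum := by
  induction s using Multiset.induction_on generalizing F with
  | empty => simp
  | cons a s ih =>
    have h : ∀ G : ι → ι → Multiset ι → M,
        ((a ::ₘ s).map fun i => (((a ::ₘ s).erase i).map fun j =>
          G i j (((a ::ₘ s).erase i).erase j)).sum).sum =
        (s.map fun j => G a j (s.erase j)).sum + ((s.map fun j => G j a (s.erase j)).sum +
          (s.map fun i => ((s.erase i).map fun j => G i j (a ::ₘ (s.erase i).erase j)).sum).sum) := by
      intro G
      rw [sum_map_erase_cons a s fun i t => (t.map fun j => G i j (t.erase j)).sum]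
      have h' : ∀ i, ((a ::ₘ s.erase i).map fun j => G i j ((a ::ₘ s.erase i).erase j)).sum =
          G i a (s.erase i) + ((s.erase i).map fun j => G i j (a ::ₘ (s.erase i).erase j)).sum :=
        fun i => sum_map_erase_cons a _ fun j t => G i j t
      simp only [h', Multiset.sum_map_add]
    rw [h F, h fun i j => F j i, ih fun i j t => F i j (a ::ₘ t)]
    abel

omit [DecidableEq ι] in
/-- A sum over decompositions in which only those with empty first part count. -/
theorem sum_antidiagonal_of_zero (s : Multiset ι) (F : Multiset ι → Multiset ι → M)
    (h : ∀ p q, p ≠ 0 → F p q = 0) :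
    (s.antidiagonal.map fun p => F p.1 p.2).sum = F 0 s := by
  induction s using Multiset.induction_on generalizing F with
  | empty => simp
  | cons a s ih =>
    rw [sum_antidiagonal_cons, ih (fun p q => F p (a ::ₘ q)) fun p q hp => h _ _ hp]
    simp [h _ _ (Multiset.cons_ne_zero)]

/-- A sum over decompositions in which only those with a singleton as first part count. -/
theorem sum_antidiagonal_of_singleton (s : Multiset ι) (F : Multiset ι → Multiset ι → M)
    (h : ∀ p q, p.card ≠ 1 → F p q = 0) :
    (s.antidiagonal.map fun p => F p.1 p.2).sum = (s.map fun i => F {i} (s.erase i)).sum := by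
  induction s using Multiset.induction_on generalizing F with
  | empty => simpa using h 0 0 (by simp)
  | cons a s ih =>
    rw [sum_antidiagonal_cons, sum_map_erase_cons a s fun i t => F {i} t,
      ih (fun p q => F p (a ::ₘ q)) fun p q hp => h _ _ hp,
      sum_antidiagonal_of_zero s (fun p q => F (a ::ₘ p) q) fun p q hp => h _ _ (by simpa using hp),
      add_comm]
    rfl

end MultisetSums

/-! ### Symmetrised products in an associative algebra -/

section SymProd

variable (K : Type*) {ι W : Type*} [Field K] [DecidableEq ι] [Ring W] [Algebra K W]

/-- Auxiliary recursion for `symProd`. -/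
def symProdAux (e : ι → W) : ℕ → Multiset ι → W
  | 0, _ => 1
  | n + 1, α => ((n + 1 : ℕ) : K)⁻¹ • (α.map fun i => e i * symProdAux e n (α.erase i)).sum

/-- The symmetrised product `(1/k!) ∑ σ, e i_σ(1) ⋯ e i_σ(k)` of a family of elements of an
associative algebra over a multiset of indices. -/
def symProd (e : ι → W) (α : Multiset ι) : W := symProdAux K e α.card α

@[simp] theorem symProd_zero (e : ι → W) : symProd K e 0 = 1 := rfl

variable {K}

theorem map_symProd {W' F : Type*} [Ring W'] [Algebra K W'] [FunLike F W W'] [AlgHomClass F K W W']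
    (φ : F) (e : ι → W) (α : Multiset ι) : φ (symProd K e α) = symProd K (fun i => φ (e i)) α := by
  unfold symProd
  generalize α.card = n
  induction n generalizing α with
  | zero => simp [symProdAux]
  | succ n ih => simp [symProdAux, map_multiset_sum, Multiset.map_map, ih]

variable [CharZero K]

/-- The recursion by the first factor, freed of division. With `symProd_eq_of_card_smul` it
characterises `symProd` inductively. -/
theorem card_smul_symProd (e : ι → W) (α : Multiset ι) :
    (α.card : K) • symProd K e α = (α.map fun i => e i * symProd K e (α.erase i)).sum := by
  rcases h : α.card with _ | n
  · rw [Multiset.card_eq_zero] at h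
    subst h
    simp
  · have h0 : ((n + 1 : ℕ) : K) ≠ 0 := Nat.cast_ne_zero.2 (Nat.succ_ne_zero n)
    rw [symProd, h, symProdAux, smul_inv_smul₀ h0]
    congr 1
    refine Multiset.map_congr rfl fun i hi => ?_
    rw [symProd, Multiset.card_erase_of_mem hi, h]
    rfl

theorem symProd_eq_of_card_smul {α : Multiset ι} (hα : α ≠ 0) {e : ι → W} {x : W}
    (h : (α.card : K) • x = (α.map fun i => e i * symProd K e (α.erase i)).sum) :
    symProd K e α = x := by
  have h0 : (α.card : K) ≠ 0 := Nat.cast_ne_zero.2 (by simpa using hα)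
  exact smul_right_injective W h0 ((card_smul_symProd e α).trans h.symm)

theorem symProd_singleton (e : ι → W) (i : ι) : symProd K e {i} = e i :=
  symProd_eq_of_card_smul (by simp) (by simp)

/-- Induction over multisets by removing one element. -/
theorem multiset_erase_induction {p : Multiset ι → Prop} (α : Multiset ι)
    (h : ∀ α : Multiset ι, (∀ i ∈ α, p (α.erase i)) → p α) : p α := by
  induction α using Multiset.strongInductionOn with
  | ih α ih => exact h α fun i hi => ih _ (Multiset.erase_lt.2 hi)

/-- Expanding once more, from the right on one side and from the left on the other, turns both sides
into the sum over the choices of a first and a last factor. -/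
theorem card_smul_symProd_right (e : ι → W) (α : Multiset ι) :
    (α.card : K) • symProd K e α = (α.map fun i => symProd K e (α.erase i) * e i).sum := by
  induction α using multiset_erase_induction with
  | h α ih =>
    rcases h : α.card with _ | _ | n
    · rw [Multiset.card_eq_zero] at h
      subst h
      simp
    · obtain ⟨i, rfl⟩ := Multiset.card_eq_one.1 h
      simp [symProd_singleton]
    · rw [← h, card_smul_symProd]
      have h0 : ((n + 1 : ℕ) : K) ≠ 0 := Nat.cast_ne_zero.2 (Nat.succ_ne_zero n)
      refine smul_right_injective W h0 ?_
      simp only [Multiset.smul_sum, Multiset.map_map, Function.comp_def]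
      have hc : ∀ i ∈ α, (α.erase i).card = n + 1 := fun i hi => by
        rw [Multiset.card_erase_of_mem hi, h]; rfl
      have h1 : (α.map fun i => ((n + 1 : ℕ) : K) • (e i * symProd K e (α.erase i))) =
          α.map fun i => ((α.erase i).map fun j =>
            e i * (symProd K e ((α.erase i).erase j) * e j)).sum :=
        Multiset.map_congr rfl fun i hi => by
          rw [← mul_smul_comm, ← hc i hi, ih i hi, Multiset.sum_map_mul_left]
      have h2 : (α.map fun i => ((n + 1 : ℕ) : K) • (symProd K e (α.erase i) * e i)) =
          α.map fun i => ((α.erase i).map fun j =>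
            e j * (symProd K e ((α.erase i).erase j) * e i)).sum :=
        Multiset.map_congr rfl fun i hi => by
          rw [← smul_mul_assoc, ← hc i hi, card_smul_symProd, ← Multiset.sum_map_mul_right]
          simp only [mul_assoc]
      rw [h1, h2]
      exact sum_erase_erase_comm α fun i j t => e i * (symProd K e t * e j)

omit [CharZero K] in
theorem commute_symProd {x : W} {e : ι → W} (h : ∀ i, Commute x (e i)) (α : Multiset ι) :
    Commute x (symProd K e α) := by
  unfold symProd
  generalize α.card = n
  induction n generalizing α with
  | zero => exact Commute.one_right x
  | succ n ih =>
    refine Commute.smul_right (Multiset.sum_induction _ _ (fun a b => Commute.add_right)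
      (Commute.zero_right x) ?_) _
    intro y hy
    obtain ⟨i, _, rfl⟩ := Multiset.mem_map.1 hy
    exact (h i).mul_right (ih _)

/-- A binomial theorem: since the two families commute, all factors from `e` can be moved to the
left. -/
theorem symProd_add {e e' : ι → W} (h : ∀ i j, Commute (e i) (e' j)) (α : Multiset ι) :
    symProd K (fun i => e i + e' i) α =
      (α.antidiagonal.map fun p => symProd K e p.1 * symProd K e' p.2).sum := by
  induction α using multiset_erase_induction with
  | h α ih =>
    rcases eq_or_ne α 0 with rfl | hα
    · simp
    refine symProd_eq_of_card_smul hα ?_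
    have h1 : (α.map fun i => (e i + e' i) * symProd K (fun i => e i + e' i) (α.erase i)) =
        α.map fun i => ((α.erase i).antidiagonal.map fun p =>
            (e i * symProd K e p.1) * symProd K e' p.2).sum +
          ((α.erase i).antidiagonal.map fun p =>
            symProd K e p.1 * (e' i * symProd K e' p.2)).sum :=
      Multiset.map_congr rfl fun i hi => by
        rw [ih i hi, ← Multiset.sum_map_add, ← Multiset.sum_map_mul_left]
        refine congrArg _ (Multiset.map_congr rfl fun p _ => ?_)
        rw [add_mul, ← mul_assoc, ← mul_assoc, ← mul_assoc,
          (commute_symProd (fun j => (h j i).symm) p.1).eq]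
    rw [h1, Multiset.sum_map_add,
      sum_erase_antidiagonal_left α fun i p q => (e i * symProd K e p) * symProd K e' q,
      sum_erase_antidiagonal_right α fun i p q => symProd K e p * (e' i * symProd K e' q),
      ← Multiset.sum_map_add, Multiset.smul_sum, Multiset.map_map]
    refine congrArg _ (Multiset.map_congr rfl fun p hp => ?_)
    rw [Multiset.sum_map_mul_right, Multiset.sum_map_mul_left, ← card_smul_symProd,
      ← card_smul_symProd, smul_mul_assoc, mul_smul_comm, ← add_smul, ← Nat.cast_add,
      ← Multiset.card_add, Multiset.mem_antidiagonal.1 hp]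
    rfl

/-- For `y ↦ e i * y + y * e i` in place of multiplication, symmetrised products are scaled by a
power of two. -/
theorem symProd_mulLeft_add_mulRight (e : ι → W) (α : Multiset ι) :
    symProd K (fun i => LinearMap.mulLeft K (e i) + LinearMap.mulRight K (e i)) α 1 =
      (2 : K) ^ α.card • symProd K e α := by
  induction α using multiset_erase_induction with
  | h α ih =>
    rcases eq_or_ne α 0 with rfl | hα
    · simp
    have h0 : (α.card : K) ≠ 0 := Nat.cast_ne_zero.2 (by simpa using hα)
    refine smul_right_injective W h0 ?_
    simp only
    set J : ι → Module.End K W := fun i => LinearMap.mulLeft K (e i) + LinearMap.mulRight K (e i)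
    obtain ⟨n, hn⟩ : ∃ n, α.card = n + 1 := Nat.exists_eq_succ_of_ne_zero (by simpa using hα)
    have h1 : (α.map fun i => (J i * symProd K J (α.erase i)) 1) =
        α.map fun i => (2 : K) ^ n • (e i * symProd K e (α.erase i)) +
          (2 : K) ^ n • (symProd K e (α.erase i) * e i) :=
      Multiset.map_congr rfl fun i hi => by
        rw [Module.End.mul_apply, ih i hi, Multiset.card_erase_of_mem hi, hn]
        simp [J]
    have h2 : ((α.map fun i => J i * symProd K J (α.erase i)).sum) 1 =
        (α.map fun i => (J i * symProd K J (α.erase i)) 1).sum := by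
      rw [← LinearMap.applyₗ_apply_apply (R := K) (1 : W), map_multiset_sum, Multiset.map_map]
      rfl
    rw [← LinearMap.smul_apply, card_smul_symProd, h2, h1, Multiset.sum_map_add]
    have h3 : ∀ f : ι → W, (α.map fun i => (2 : K) ^ n • f i).sum = (2 : K) ^ n • (α.map f).sum :=
      fun f => by rw [Multiset.smul_sum, Multiset.map_map]; rfl
    -- The left and the right recursion yield the same sum, which supplies one more factor 2.
    rw [h3, h3, ← card_smul_symProd, ← card_smul_symProd_right, ← add_smul, ← two_mul, hn,
      ← pow_succ', smul_comm]

/-- The sum over all orderings of a product is a multiple of the symmetrised product. -/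
theorem sum_perm_prod (e : ι → W) {k : ℕ} (h : Fin k → ι) :
    ∑ σ : Equiv.Perm (Fin k), (List.ofFn fun i => e (h (σ i))).prod =
      (k.factorial : K) • symProd K e (List.ofFn h : Multiset ι) := by
  induction k with
  | zero => simp
  | succ k ih =>
    -- Permutations are sorted by their value p at 0; the remaining factors form the multiset with
    -- `h p` erased.
    rw [← Equiv.sum_comp Equiv.Perm.decomposeFin.symm, Fintype.sum_prod_type]
    have hm : ∀ p : Fin (k + 1),
        ((List.ofFn fun i : Fin k => h (Equiv.swap 0 p i.succ) : List ι) : Multiset ι) =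
          (List.ofFn h : Multiset ι).erase (h p) := by
      intro p
      have h1 : (List.ofFn (h ∘ Equiv.swap 0 p)).Perm (List.ofFn h) :=
        Equiv.Perm.ofFn_comp_perm _ _
      rw [← Multiset.coe_eq_coe.2 h1, List.ofFn_succ]
      simp
    have h2 : ∀ p : Fin (k + 1), ∑ σ : Equiv.Perm (Fin k),
        (List.ofFn fun i => e (h (Equiv.Perm.decomposeFin.symm (p, σ) i))).prod =
          (k.factorial : K) • (e (h p) * symProd K e ((List.ofFn h : Multiset ι).erase (h p))) := by
      intro p
      rw [← hm, ← mul_smul_comm, ← ih, Finset.mul_sum]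
      refine Finset.sum_congr rfl fun σ _ => ?_
      rw [List.ofFn_succ, List.prod_cons]
      simp
    simp only [h2]
    rw [← Finset.smul_sum, Nat.factorial_succ, mul_comm, Nat.cast_mul, mul_smul]
    congr 1
    have h3 := card_smul_symProd (K := K) e (List.ofFn h : Multiset ι)
    rw [Multiset.coe_card, List.length_ofFn] at h3
    rw [h3, Multiset.map_coe, Multiset.sum_coe, List.map_ofFn, List.sum_ofFn]
    rfl

end SymProd

/-! ### Independence of symmetrised products of primitive elements -/

section Independence

open TensorProduct

variable {K ι U : Type*} [Field K] [CharZero K] [DecidableEq ι] [Ring U] [Algebra K U]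

/-- The families e ⊗ 1 and 1 ⊗ e commute, so `symProd_add` applies to their sum. -/
theorem coproduct_symProd (Δ : U →ₐ[K] U ⊗[K] U) {e : ι → U}
    (hΔ : ∀ i, Δ (e i) = e i ⊗ₜ 1 + 1 ⊗ₜ e i) (α : Multiset ι) :
    Δ (symProd K e α) =
      (α.antidiagonal.map fun p => symProd K e p.1 ⊗ₜ[K] symProd K e p.2).sum := by
  rw [map_symProd]
  simp only [hΔ]
  rw [symProd_add (e := fun i => e i ⊗ₜ[K] (1 : U)) (e' := fun i => (1 : U) ⊗ₜ[K] e i)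
    fun i j => by simp [Commute, SemiconjBy]]
  refine congrArg _ (Multiset.map_congr rfl fun p _ => ?_)
  have h1 := map_symProd (Algebra.TensorProduct.includeLeft : U →ₐ[K] U ⊗[K] U) e p.1
  have h2 := map_symProd (Algebra.TensorProduct.includeRight : U →ₐ[K] U ⊗[K] U) e p.2
  simp only [Algebra.TensorProduct.includeLeft_apply] at h1
  simp only [Algebra.TensorProduct.includeRight_apply] at h2
  rw [← h1, ← h2]
  simp

/-- Symmetrised products of linearly independent primitive elements are linearly independent. -/
theorem linearIndependent_symProd (Δ : U →ₐ[K] U ⊗[K] U) (ε : U →ₐ[K] K) {e : ι → U}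
    (hΔ : ∀ i, Δ (e i) = e i ⊗ₜ 1 + 1 ⊗ₜ e i) (hε : ∀ i, ε (e i) = 0)
    (he : LinearIndependent K e) : LinearIndependent K (symProd K e) := by
  obtain ⟨g, hg⟩ : ∃ g : U →ₗ[K] MvPolynomial ι K, ∀ i, g (e i) = MvPolynomial.X i := by
    obtain ⟨g, hg⟩ := LinearMap.exists_leftInverse_of_injective
      (Finsupp.linearCombination K e) (LinearMap.ker_eq_bot.2 he)
    refine ⟨(Finsupp.linearCombination K fun i => (MvPolynomial.X i : MvPolynomial ι K)) ∘ₗ g,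
      fun i => ?_⟩
    have := LinearMap.congr_fun hg (Finsupp.single i 1)
    simp only [LinearMap.comp_apply, Finsupp.linearCombination_single, one_smul,
      LinearMap.id_apply] at this
    simp [this]
  -- The correction makes ρ kill 1 without changing it on the `e i`, where the counit vanishes.
  let ρ : U →ₗ[K] MvPolynomial ι K := g - (LinearMap.toSpanSingleton K _ (g 1)) ∘ₗ ε.toLinearMap
  have hρ1 : ρ 1 = 0 := by simp [ρ]
  have hρ : ∀ i, ρ (e i) = MvPolynomial.X i := by simp [ρ, hε, hg]
  -- `Cn n` splits off n tensor factors by the coproduct, applies ρ to them and the counit to the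
  -- rest, and multiplies. It kills symmetrised products of fewer than n factors, as some ρ then
  -- meets 1; on n factors it gives n! times the monomial.
  let Cn : ℕ → U →ₗ[K] MvPolynomial ι K := fun n =>
    Nat.rec ((Algebra.linearMap K _) ∘ₗ ε.toLinearMap)
      (fun _ c => LinearMap.mul' K _ ∘ₗ TensorProduct.map ρ c ∘ₗ Δ.toLinearMap) n
  have hC0 : ∀ u, Cn 0 u = MvPolynomial.C (ε u) := fun u => rfl
  have hCs : ∀ n α, Cn (n + 1) (symProd K e α) =
      (α.antidiagonal.map fun p => ρ (symProd K e p.1) * Cn n (symProd K e p.2)).sum := by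
    intro n α
    change LinearMap.mul' K _ (TensorProduct.map ρ (Cn n) (Δ (symProd K e α))) = _
    rw [coproduct_symProd Δ hΔ, map_multiset_sum, map_multiset_sum, Multiset.map_map,
      Multiset.map_map]
    rfl
  have key : ∀ n (α : Multiset ι), (α.card < n → Cn n (symProd K e α) = 0) ∧
      (α.card = n → Cn n (symProd K e α) =
        (n.factorial : K) • (α.map fun i => (MvPolynomial.X i : MvPolynomial ι K)).prod) := by
    intro n
    induction n with
    | zero =>
      intro α
      refine ⟨fun h => absurd h (Nat.not_lt_zero _), fun h => ?_⟩
      rw [Multiset.card_eq_zero] at h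
      subst h
      simp [hC0]
    | succ n ih =>
      intro α
      have hsum : ∀ p ∈ α.antidiagonal, p.1.card + p.2.card = α.card := fun p hp => by
        rw [← Multiset.card_add, Multiset.mem_antidiagonal.1 hp]
      refine ⟨fun h => ?_, fun h => ?_⟩
      · rw [hCs]
        refine Multiset.sum_eq_zero fun x hx => ?_
        obtain ⟨p, hp, rfl⟩ := Multiset.mem_map.1 hx
        rcases eq_or_ne p.1 0 with h0 | h0
        · simp [h0, hρ1]
        · have := hsum p hp
          have h1 : 0 < p.1.card := Multiset.card_pos.2 h0
          rw [(ih p.2).1 (by omega), mul_zero]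
      · have h1 : ∀ p ∈ α.antidiagonal, ρ (symProd K e p.1) * Cn n (symProd K e p.2) =
            if p.1.card = 1 then ρ (symProd K e p.1) * Cn n (symProd K e p.2) else 0 := by
          intro p hp
          split_ifs with hc
          · rfl
          · rcases eq_or_ne p.1 0 with h0 | h0
            · simp [h0, hρ1]
            · have := hsum p hp
              have h1 : 0 < p.1.card := Multiset.card_pos.2 h0
              rw [(ih p.2).1 (by omega), mul_zero]
        rw [hCs, Multiset.map_congr rfl h1, sum_antidiagonal_of_singleton α
          (fun p q => if p.card = 1 then ρ (symProd K e p) * Cn n (symProd K e q) else 0)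
          fun p q hp => by simp [hp]]
        have h2 : ∀ i ∈ α, (if Multiset.card {i} = 1 then
            ρ (symProd K e {i}) * Cn n (symProd K e (α.erase i)) else 0) =
              (n.factorial : K) • (α.map fun i => (MvPolynomial.X i : MvPolynomial ι K)).prod := by
          intro i hi
          rw [if_pos (by simp), symProd_singleton, hρ,
            (ih (α.erase i)).2 (by rw [Multiset.card_erase_of_mem hi, h]; rfl), mul_smul_comm,
            Multiset.prod_map_erase (f := fun i => (MvPolynomial.X i : MvPolynomial ι K)) hi]
        rw [Multiset.map_congr rfl h2, Multiset.map_const', Multiset.sum_replicate, h,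
          Nat.factorial_succ, Nat.cast_mul, mul_smul, Nat.cast_smul_eq_nsmul K (n + 1)]
  rw [linearIndependent_iff]
  intro l hl
  by_contra hne
  -- With n the largest number of factors in a relation, only the terms with n factors survive `Cn
  -- n`, and their monomials are distinct.
  obtain ⟨α₀, hα₀, hmax⟩ := l.support.exists_max_image Multiset.card
    (Finsupp.support_nonempty_iff.2 hne)
  have h1 : Cn α₀.card (Finsupp.linearCombination K (symProd K e) l) = 0 := by rw [hl, map_zero]
  rw [Finsupp.linearCombination_apply, Finsupp.sum, map_sum] at h1
  have hX : ∀ α : Multiset ι, (α.map fun i => (MvPolynomial.X i : MvPolynomial ι K)).prod =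
      MvPolynomial.monomial (Multiset.toFinsupp α) 1 := by
    intro α
    induction α using Multiset.induction_on with
    | empty => simp
    | cons a s ih =>
      rw [Multiset.map_cons, Multiset.prod_cons, ih, MvPolynomial.X, MvPolynomial.monomial_mul,
        ← Multiset.singleton_add, map_add, Multiset.toFinsupp_singleton, one_mul]
  have h2 := congrArg (MvPolynomial.coeff (Multiset.toFinsupp α₀)) h1
  rw [MvPolynomial.coeff_sum, MvPolynomial.coeff_zero, Finset.sum_eq_single α₀] at h2
  · rw [map_smul, (key _ α₀).2 rfl, hX] at h2
    simp only [MvPolynomial.coeff_smul, MvPolynomial.coeff_monomial, if_true, smul_eq_mul, mul_one,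
      mul_eq_zero, Nat.cast_eq_zero] at h2
    rcases h2 with h2 | h2
    · exact Finsupp.mem_support_iff.1 hα₀ h2
    · exact Nat.factorial_ne_zero _ h2
  · intro α hα hαne
    rw [map_smul]
    rcases (hmax α hα).lt_or_eq with hc | hc
    · rw [(key _ α).1 hc]; simp
    · rw [(key _ α).2 hc, hX]
      have : Multiset.toFinsupp α ≠ Multiset.toFinsupp α₀ := fun h =>
        hαne (Multiset.toFinsupp.injective h)
      simp [MvPolynomial.coeff_monomial, this]
  · exact fun h => absurd hα₀ h

end Independence

end LieTriple

end

noncomputable section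

namespace LieTriple

open TensorProduct MulOpposite

/-! ### The formal symmetric space and its vector fields -/

section FreeModel

variable (K X : Type*) [Field K]

/-- The coproduct of the free associative algebra for which the letters are primitive. -/
def freeCoprod : FreeAlgebra K X →ₐ[K] FreeAlgebra K X ⊗[K] FreeAlgebra K X :=
  FreeAlgebra.lift K fun x => FreeAlgebra.ι K x ⊗ₜ 1 + 1 ⊗ₜ FreeAlgebra.ι K x

/-- The involution `θ` of the free associative algebra which changes the sign of the letters. -/
def freeSign : FreeAlgebra K X →ₐ[K] FreeAlgebra K X :=
  FreeAlgebra.lift K fun x => -FreeAlgebra.ι K x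

/-- The right adjoint action, a letter `x` acting by `y ↦ y x - x y`. -/
def freeAd : FreeAlgebra K X →ₐ[K] (Module.End K (FreeAlgebra K X))ᵐᵒᵖ :=
  FreeAlgebra.lift K fun x =>
    op (LinearMap.mulRight K (FreeAlgebra.ι K x) - LinearMap.mulLeft K (FreeAlgebra.ι K x))

/-- The action `p · y = p y θ(p)⁻¹`, a letter `x` acting by `y ↦ x y + y x`. -/
def freeTwist : FreeAlgebra K X →ₐ[K] Module.End K (FreeAlgebra K X) :=
  FreeAlgebra.lift K fun x =>
    LinearMap.mulLeft K (FreeAlgebra.ι K x) + LinearMap.mulRight K (FreeAlgebra.ι K x)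

/-- The elements which behave like Lie elements for the coproduct and the actions. -/
def lieLike : Submodule K (FreeAlgebra K X) where
  carrier := {x | freeCoprod K X x = x ⊗ₜ 1 + 1 ⊗ₜ x ∧
    freeAd K X x = op (LinearMap.mulRight K x - LinearMap.mulLeft K x) ∧
    freeTwist K X x = LinearMap.mulLeft K x - LinearMap.mulRight K (freeSign K X x) ∧
    FreeAlgebra.algebraMapInv x = (0 : K)}
  add_mem' := by
    rintro x y ⟨h1, h2, h3, h4⟩ ⟨k1, k2, k3, k4⟩
    refine ⟨?_, ?_, ?_, ?_⟩
    · rw [map_add, h1, k1, add_tmul, tmul_add]; abel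
    · rw [map_add, h2, k2, ← op_add]
      congr 1
      ext z
      simp [mul_add, add_mul]
      abel
    · rw [map_add, h3, k3]
      ext z
      simp [mul_add, add_mul]
      abel
    · rw [map_add, h4, k4, add_zero]
  zero_mem' := by
    refine ⟨by simp, ?_, ?_, by simp⟩
    · rw [map_zero, ← op_zero]
      congr 1
      ext z
      simp
    · rw [map_zero]
      ext z
      simp
  smul_mem' := by
    rintro c x ⟨h1, h2, h3, h4⟩
    refine ⟨?_, ?_, ?_, ?_⟩
    · rw [map_smul, h1, smul_add, smul_tmul', tmul_smul]
    · rw [map_smul, h2, ← op_smul]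
      congr 1
      ext z
      simp [smul_sub]
    · rw [map_smul, h3]
      ext z
      simp [smul_sub]
    · rw [map_smul, h4, smul_zero]

/-- The odd Lie-like elements. -/
def oddPart : Submodule K (FreeAlgebra K X) :=
  lieLike K X ⊓ LinearMap.ker ((freeSign K X).toLinearMap + LinearMap.id)

variable {K X}

local notation "Δ" => freeCoprod K X
local notation "θ" => freeSign K X

theorem mem_oddPart {x : FreeAlgebra K X} :
    x ∈ oddPart K X ↔ x ∈ lieLike K X ∧ θ x = -x := by
  simp [oddPart, add_eq_zero_iff_eq_neg]

theorem ι_mem_oddPart (x : X) : FreeAlgebra.ι K x ∈ oddPart K X := by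
  refine mem_oddPart.2 ⟨⟨by simp [freeCoprod], by simp [freeAd], ?_, ?_⟩, by simp [freeSign]⟩
  · ext z
    simp [freeTwist, freeSign]
  · simp [FreeAlgebra.algebraMapInv]

theorem lie_mem_lieLike {x y : FreeAlgebra K X} (hx : x ∈ lieLike K X) (hy : y ∈ lieLike K X) :
    ⁅x, y⁆ ∈ lieLike K X := by
  obtain ⟨h1, h2, h3, h4⟩ := hx
  obtain ⟨k1, k2, k3, k4⟩ := hy
  rw [Ring.lie_def]
  refine ⟨?_, ?_, ?_, ?_⟩
  · rw [map_sub, map_mul, map_mul, h1, k1]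
    simp only [mul_add, add_mul, Algebra.TensorProduct.tmul_mul_tmul, mul_one, one_mul, sub_tmul,
      tmul_sub]
    abel
  · rw [map_sub, map_mul, map_mul, h2, k2, ← op_mul, ← op_mul, ← op_sub]
    congr 1
    refine LinearMap.ext fun z => ?_
    simp only [LinearMap.sub_apply, Module.End.mul_apply, LinearMap.mulRight_apply,
      LinearMap.mulLeft_apply]
    noncomm_ring
  · rw [map_sub, map_mul, map_mul, h3, k3]
    refine LinearMap.ext fun z => ?_
    simp only [LinearMap.sub_apply, Module.End.mul_apply, LinearMap.mulRight_apply,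
      LinearMap.mulLeft_apply, map_sub, map_mul]
    noncomm_ring
  · simp [h4, k4]

theorem lie_lie_mem_oddPart {x y z : FreeAlgebra K X} (hx : x ∈ oddPart K X)
    (hy : y ∈ oddPart K X) (hz : z ∈ oddPart K X) : ⁅z, ⁅x, y⁆⁆ ∈ oddPart K X := by
  rw [mem_oddPart] at *
  refine ⟨lie_mem_lieLike hz.1 (lie_mem_lieLike hx.1 hy.1), ?_⟩
  simp only [Ring.lie_def, map_sub, map_mul, hx.2, hy.2, hz.2]
  noncomm_ring

theorem hallPoly_mem_oddPart (t : TripleMagma X) : hallPoly K t ∈ oddPart K X := by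
  induction t with
  | leaf x => exact ι_mem_oddPart x
  | bracket u v w hu hv hw => exact lie_lie_mem_oddPart hu hv hw

theorem freeAd_mem {y : FreeAlgebra K X} (hy : y ∈ lieLike K X) (u : FreeAlgebra K X) :
    (freeAd K X u).unop y ∈ lieLike K X := by
  induction u using FreeAlgebra.induction generalizing y with
  | grade0 r => simpa [Algebra.algebraMap_eq_smul_one] using Submodule.smul_mem _ r hy
  | grade1 x => simpa [freeAd, Ring.lie_def] using lie_mem_lieLike hy (mem_oddPart.1 (ι_mem_oddPart x)).1
  | mul a b ha hb => simpa using hb (ha hy)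
  | add a b ha hb => simpa using add_mem (ha hy) (hb hy)

theorem freeSign_freeAd (u y : FreeAlgebra K X) :
    θ ((freeAd K X u).unop y) = (freeAd K X (θ u)).unop (θ y) := by
  induction u using FreeAlgebra.induction generalizing y with
  | grade0 r => simp [Algebra.algebraMap_eq_smul_one]
  | grade1 x => simp [freeAd, freeSign, neg_add_eq_sub]
  | mul a b ha hb => simp [ha, hb]
  | add a b ha hb => simp [ha, hb]

theorem freeSign_freeSign (u : FreeAlgebra K X) : θ (θ u) = u := by
  induction u using FreeAlgebra.induction with
  | grade0 r => simp
  | grade1 x => simp [freeSign]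
  | mul a b ha hb => simp [ha, hb]
  | add a b ha hb => simp [ha, hb]

variable (K X) in
/-- The operators `Ad(p)⁻¹ + Ad(θ p)⁻¹`. -/
def evenAd : FreeAlgebra K X →ₗ[K] FreeAlgebra K X →ₗ[K] FreeAlgebra K X :=
  (opLinearEquiv K).symm.toLinearMap ∘ₗ (freeAd K X).toLinearMap ∘ₗ
    (LinearMap.id + (freeSign K X).toLinearMap)

theorem evenAd_apply (u y : FreeAlgebra K X) :
    evenAd K X u y = (freeAd K X u).unop y + (freeAd K X (θ u)).unop y := by
  simp [evenAd]

theorem evenAd_one (y : FreeAlgebra K X) : evenAd K X 1 y = (2 : K) • y := by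
  simp [evenAd_apply, two_smul]

/-- θ exchanges the two summands of `evenAd` and changes the sign of `y`, so their sum is odd for
every `u`. -/
theorem evenAd_mem {y : FreeAlgebra K X} (hy : y ∈ oddPart K X) (u : FreeAlgebra K X) :
    evenAd K X u y ∈ oddPart K X := by
  rw [mem_oddPart] at hy
  rw [evenAd_apply, mem_oddPart]
  refine ⟨add_mem (freeAd_mem hy.1 _) (freeAd_mem hy.1 _), ?_⟩
  rw [map_add, freeSign_freeAd, freeSign_freeAd, freeSign_freeSign, hy.2]
  simp

/-- A vector field on the symmetric space, as a function on the group: it has values in the odd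
part and is equivariant for the even part. -/
def IsField (f : FreeAlgebra K X →ₗ[K] FreeAlgebra K X) : Prop :=
  ∀ u, f u ∈ oddPart K X ∧ ∀ x ∈ oddPart K X, ∀ y ∈ oddPart K X, f (u * ⁅x, y⁆) = ⁅f u, ⁅x, y⁆⁆

/-- Infinitesimally: p θ(p)⁻¹ does not change when p is multiplied on the right by a fixed point of
θ. -/
theorem freeTwist_even {x y : FreeAlgebra K X} (hx : x ∈ oddPart K X) (hy : y ∈ oddPart K X) :
    freeTwist K X ⁅x, y⁆ 1 = 0 := by
  rw [mem_oddPart] at hx hy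
  rw [(lie_mem_lieLike hx.1 hy.1).2.2.1]
  simp [Ring.lie_def, hx.2, hy.2]

variable (ψ : FreeAlgebra K X →ₗ[K] FreeAlgebra K X)

/-- The vector field `Ad(p)⁻¹ ψ(q) + Ad(θ p)⁻¹ ψ(q)`, where `q = p θ(p)⁻¹`. -/
def spreadField : FreeAlgebra K X →ₗ[K] FreeAlgebra K X :=
  TensorProduct.lift ((evenAd K X).compl₂
    (ψ ∘ₗ LinearMap.applyₗ 1 ∘ₗ (freeTwist K X).toLinearMap)) ∘ₗ (Δ).toLinearMap

/-- Moving p to p h with θ(h) = h leaves q = p θ(p)⁻¹ unchanged and composes both adjoint operators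
with that of h⁻¹, which is the required equivariance. This is how an arbitrary odd function ψ
becomes a vector field. -/
theorem isField_spreadField (hψ : ∀ u, ψ u ∈ oddPart K X) : IsField (spreadField ψ) := by
  set L := TensorProduct.lift ((evenAd K X).compl₂
    (ψ ∘ₗ LinearMap.applyₗ 1 ∘ₗ (freeTwist K X).toLinearMap)) with hL
  have hpure : ∀ a b, L (a ⊗ₜ b) = evenAd K X a (ψ (freeTwist K X b 1)) := fun a b => rfl
  intro u
  change L (Δ u) ∈ _ ∧ ∀ x ∈ _, ∀ y ∈ _, L (Δ _) = ⁅L (Δ u), _⁆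
  refine ⟨?_, fun x hx y hy => ?_⟩
  · induction Δ u using TensorProduct.induction_on with
    | zero => simp
    | tmul a b => rw [hpure]; exact evenAd_mem (hψ _) _
    | add s t hs ht => rw [map_add]; exact add_mem hs ht
  · have hQ := freeTwist_even hx hy
    rw [mem_oddPart] at hx hy
    have hl := lie_mem_lieLike hx.1 hy.1
    have hθ : θ ⁅x, y⁆ = ⁅x, y⁆ := by simp [Ring.lie_def, hx.2, hy.2]
    generalize ⁅x, y⁆ = h at *
    rw [map_mul, hl.1]
    rw [Ring.lie_def]
    induction Δ u using TensorProduct.induction_on with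
    | zero => simp
    | tmul a b =>
      rw [mul_add, Algebra.TensorProduct.tmul_mul_tmul, Algebra.TensorProduct.tmul_mul_tmul,
        map_add, hpure, hpure, hpure, mul_one, mul_one, map_mul (freeTwist K X),
        Module.End.mul_apply, hQ, map_zero, map_zero, map_zero, add_zero, evenAd_apply,
        evenAd_apply, map_mul, map_mul, map_mul, hθ, hl.2.1]
      simp [mul_add, add_mul]
      abel
    | add s t hs ht => rw [add_mul, map_add, hs, ht, map_add, add_mul, mul_add]; abel

variable {ι : Type*} [DecidableEq ι] [CharZero K]

/-- Recursive solution of a triangular system of equations indexed by multisets. -/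
def triangularSolve (T : Multiset ι → FreeAlgebra K X →ₗ[K] FreeAlgebra K X)
    (Λ : Multiset ι → FreeAlgebra K X) (α : Multiset ι) : FreeAlgebra K X :=
  (2 : K)⁻¹ • (Λ α - (α.antidiagonal.attach.map fun p =>
    if _h : p.1.1 = 0 then 0 else T p.1.1 (triangularSolve T Λ p.1.2)).sum)
termination_by α.card
decreasing_by
  have h1 := congrArg Multiset.card (Multiset.mem_antidiagonal.1 p.2)
  rw [Multiset.card_add] at h1
  have h2 := Multiset.card_pos.2 _h
  omega

omit [CharZero K] in
theorem triangularSolve_eq (T : Multiset ι → FreeAlgebra K X →ₗ[K] FreeAlgebra K X)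
    (Λ : Multiset ι → FreeAlgebra K X) (α : Multiset ι) :
    triangularSolve T Λ α = (2 : K)⁻¹ • (Λ α - (α.antidiagonal.map fun p =>
      if p.1 = 0 then 0 else T p.1 (triangularSolve T Λ p.2)).sum) := by
  rw [triangularSolve]
  congr 3
  exact Multiset.attach_map_val' _ fun p : Multiset ι × Multiset ι =>
    if p.1 = 0 then 0 else T p.1 (triangularSolve T Λ p.2)

/-- The term with empty first part is twice the unknown at α; all other terms involve unknowns at
smaller multisets. -/
theorem triangularSolve_spec {T : Multiset ι → FreeAlgebra K X →ₗ[K] FreeAlgebra K X}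
    (hT : ∀ y, T 0 y = (2 : K) • y) (Λ : Multiset ι → FreeAlgebra K X) (α : Multiset ι) :
    (α.antidiagonal.map fun p => T p.1 (triangularSolve T Λ p.2)).sum = Λ α := by
  have h : ∀ p ∈ α.antidiagonal, T p.1 (triangularSolve T Λ p.2) =
      (if p.1 = 0 then T p.1 (triangularSolve T Λ p.2) else 0) +
        (if p.1 = 0 then 0 else T p.1 (triangularSolve T Λ p.2)) := by
    intro p _
    split_ifs <;> simp
  rw [Multiset.map_congr rfl h, Multiset.sum_map_add, sum_antidiagonal_of_zero α
    (fun p q => if p = 0 then T p (triangularSolve T Λ q) else 0) fun p q hp => if_neg hp,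
    if_pos rfl, hT, triangularSolve_eq T Λ α, smul_inv_smul₀ two_ne_zero, sub_add_cancel]

omit [CharZero K] in
theorem triangularSolve_mem {T : Multiset ι → FreeAlgebra K X →ₗ[K] FreeAlgebra K X}
    {Λ : Multiset ι → FreeAlgebra K X} {N : Submodule K (FreeAlgebra K X)} (hΛ : ∀ α, Λ α ∈ N)
    (hT : ∀ α, ∀ y ∈ N, T α y ∈ N) (α : Multiset ι) : triangularSolve T Λ α ∈ N := by
  induction hc : α.card using Nat.strong_induction_on generalizing α with
  | _ n ih =>
    rw [triangularSolve_eq]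
    refine Submodule.smul_mem _ _ (sub_mem (hΛ α) (multiset_sum_mem _ fun y hy => ?_))
    obtain ⟨p, hp, rfl⟩ := Multiset.mem_map.1 hy
    split_ifs with h0
    · exact zero_mem _
    · have h1 := congrArg Multiset.card (Multiset.mem_antidiagonal.1 hp)
      rw [Multiset.card_add] at h1
      have h2 := Multiset.card_pos.2 h0
      exact hT _ _ (ih _ (by omega) _ rfl)

/-- An odd element acts by left plus right multiplication, so `symProd_mulLeft_add_mulRight`
applies. Geometrically p ↦ p θ(p)⁻¹ sends exp x to exp 2x. -/
theorem freeTwist_symProd {e : ι → FreeAlgebra K X} (he : ∀ i, e i ∈ oddPart K X)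
    (α : Multiset ι) :
    freeTwist K X (symProd K e α) 1 = (2 : K) ^ α.card • symProd K e α := by
  rw [map_symProd, ← symProd_mulLeft_add_mulRight]
  congr 2
  funext i
  have h := mem_oddPart.1 (he i)
  rw [h.1.2.2.1, h.2]
  ext z
  simp

/-- Vector fields with prescribed symmetrised covariant derivatives at the base point. -/
theorem exists_isField {e : ι → FreeAlgebra K X} (he : ∀ i, e i ∈ oddPart K X)
    (hli : LinearIndependent K e) (Λ : Multiset ι → FreeAlgebra K X)
    (hΛ : ∀ α, Λ α ∈ oddPart K X) :
    ∃ f, IsField f ∧ ∀ α, f (symProd K e α) = Λ α := by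
  have hprim : ∀ i, Δ (e i) = e i ⊗ₜ 1 + 1 ⊗ₜ e i := fun i => (mem_oddPart.1 (he i)).1.1
  have hs := linearIndependent_symProd Δ FreeAlgebra.algebraMapInv hprim
    (fun i => (mem_oddPart.1 (he i)).1.2.2.2) hli
  -- By the coproduct formula the spread field takes on a symmetrised product the value ∑ T_β Ψ_γ
  -- over β + γ = α, where T_β is `evenAd` at the product over β; Ψ makes this equal to Λ.
  set Ψ := triangularSolve (fun α => evenAd K X (symProd K e α)) Λ with hΨ
  have hΨm : ∀ α, Ψ α ∈ oddPart K X := triangularSolve_mem hΛ fun α y hy => evenAd_mem hy _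
  obtain ⟨g, hg⟩ := LinearMap.exists_leftInverse_of_injective
    (Finsupp.linearCombination K (symProd K e)) (LinearMap.ker_eq_bot.2 hs)
  -- The independence of symmetrised products allows values to be prescribed on them; the inverse
  -- power of 2 cancels the one in `freeTwist_symProd`.
  let ψ : FreeAlgebra K X →ₗ[K] FreeAlgebra K X :=
    (Finsupp.linearCombination K fun α => ((2 : K) ^ α.card)⁻¹ • Ψ α) ∘ₗ g
  have hψs : ∀ α, ψ (symProd K e α) = ((2 : K) ^ α.card)⁻¹ • Ψ α := fun α => by
    have := LinearMap.congr_fun hg (Finsupp.single α 1)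
    simp only [LinearMap.comp_apply, Finsupp.linearCombination_single, one_smul,
      LinearMap.id_apply] at this
    simp [ψ, this]
  have hψm : ∀ u, ψ u ∈ oddPart K X := fun u => by
    simp only [ψ, LinearMap.comp_apply, Finsupp.linearCombination_apply]
    exact Submodule.sum_mem _ fun α _ =>
      Submodule.smul_mem _ _ (Submodule.smul_mem _ _ (hΨm α))
  refine ⟨spreadField ψ, isField_spreadField ψ hψm, fun α => ?_⟩
  rw [← triangularSolve_spec (T := fun α => evenAd K X (symProd K e α))
    (fun y => by rw [symProd_zero, evenAd_one]) Λ α, spreadField, LinearMap.comp_apply,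
    AlgHom.toLinearMap_apply, coproduct_symProd Δ hprim, map_multiset_sum, Multiset.map_map]
  refine congrArg _ (Multiset.map_congr rfl fun p _ => ?_)
  simp only [Function.comp_apply, TensorProduct.lift.tmul, LinearMap.compl₂_apply,
    LinearMap.comp_apply, AlgHom.toLinearMap_apply, LinearMap.applyₗ_apply_apply]
  rw [freeTwist_symProd he, map_smul, hψs, smul_inv_smul₀ (pow_ne_zero _ two_ne_zero)]

end FreeModel

end LieTriple

end

noncomputable section

namespace LieTriple

/-! ### Leibniz sums over the letters of a word -/

section LeibnizSums

variable {A M : Type*} [AddCommGroup M]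

/-- The sum of the values of `G` at the words obtained from a word by applying `f` to one of its
letters. -/
def leibnizSum (f : A → A) : (List A → M) → List A → M
  | _, [] => 0
  | G, a :: l => G (f a :: l) + leibnizSum f (fun l' => G (a :: l')) l

theorem leibnizSum_congr {f : A → A} {G G' : List A → M} {l : List A}
    (h : ∀ l', l'.length = l.length → G l' = G' l') : leibnizSum f G l = leibnizSum f G' l := by
  induction l generalizing G G' with
  | nil => rfl
  | cons a l ih =>
    simp only [leibnizSum]
    rw [h _ (by simp), ih fun l' hl' => h _ (by simp [hl'])]

theorem leibnizSum_append (f : A → A) (G : List A → M) (u v : List A) :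
    leibnizSum f G (u ++ v) =
      leibnizSum f (fun u' => G (u' ++ v)) u + leibnizSum f (fun v' => G (u ++ v')) v := by
  induction u generalizing G with
  | nil => simp [leibnizSum]
  | cons a u ih => simp [leibnizSum, ih, add_assoc]

theorem leibnizSum_add (f : A → A) (G G' : List A → M) (l : List A) :
    leibnizSum f (fun l' => G l' + G' l') l = leibnizSum f G l + leibnizSum f G' l := by
  induction l generalizing G G' with
  | nil => simp [leibnizSum]
  | cons a l ih => simp only [leibnizSum, ih]; abel

theorem leibnizSum_sub (f : A → A) (G G' : List A → M) (l : List A) :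
    leibnizSum f (fun l' => G l' - G' l') l = leibnizSum f G l - leibnizSum f G' l := by
  induction l generalizing G G' with
  | nil => simp [leibnizSum]
  | cons a l ih => simp only [leibnizSum, ih]; abel

theorem leibnizSum_zero (f : A → A) (l : List A) : leibnizSum f (fun _ => (0 : M)) l = 0 := by
  induction l with
  | nil => rfl
  | cons a l ih => simp [leibnizSum, ih]

theorem map_leibnizSum {N F : Type*} [AddCommGroup N] [FunLike F M N] [AddMonoidHomClass F M N]
    (φ : F) (f : A → A) (G : List A → M) (l : List A) :
    φ (leibnizSum f G l) = leibnizSum f (fun l' => φ (G l')) l := by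
  induction l generalizing G with
  | nil => simp [leibnizSum]
  | cons a l ih => simp [leibnizSum, ih]

theorem mul_leibnizSum {R : Type*} [NonUnitalNonAssocRing R] (z : R) (f : A → A) (G : List A → R)
    (l : List A) : z * leibnizSum f G l = leibnizSum f (fun l' => z * G l') l :=
  map_leibnizSum (AddMonoidHom.mulLeft z) f G l

theorem smul_leibnizSum {R : Type*} [Monoid R] [DistribMulAction R M] (c : R) (f : A → A)
    (G : List A → M) (l : List A) : c • leibnizSum f G l = leibnizSum f (fun l' => c • G l') l :=
  map_leibnizSum (DistribSMul.toAddMonoidHom M c) f G l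

theorem leibnizSum_leibnizSum (f g : A → A) (F : List A → List A → M) (u v : List A) :
    leibnizSum f (fun u' => leibnizSum g (fun v' => F u' v') v) u =
      leibnizSum g (fun v' => leibnizSum f (fun u' => F u' v') u) v := by
  induction u generalizing F with
  | nil => simp [leibnizSum, leibnizSum_zero]
  | cons a u ih => simp only [leibnizSum, ih, leibnizSum_add]

theorem leibnizSum_mem {S : Type*} [SetLike S M] [AddSubmonoidClass S M] (W : S) {p : A → Prop}
    {f : A → A} {G : List A → M} {l : List A} (hf : ∀ a ∈ l, p (f a)) (hl : ∀ a ∈ l, p a)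
    (h : ∀ l', l'.length = l.length → (∀ a ∈ l', p a) → G l' ∈ W) : leibnizSum f G l ∈ W := by
  induction l generalizing G with
  | nil => exact zero_mem W
  | cons a l ih =>
    simp only [List.forall_mem_cons] at hl hf
    refine add_mem (h _ (by simp) ?_) (ih hf.2 hl.2 fun l' hl' hp => h _ (by simp [hl']) ?_)
    · simpa using ⟨hf.1, hl.2⟩
    · simpa using ⟨hl.1, hp⟩

theorem leibnizSum_ofFn (f : A → A) (G : List A → M) {k : ℕ} (t : Fin k → A) :
    leibnizSum f G (List.ofFn t) = ∑ i, G (List.ofFn (Function.update t i (f (t i)))) := by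
  induction k generalizing G with
  | zero => simp [leibnizSum]
  | succ k ih =>
    rw [List.ofFn_succ, leibnizSum, ih, Fin.sum_univ_succ]
    congr 1
    · rw [List.ofFn_succ]
      simp
    · refine Finset.sum_congr rfl fun i _ => ?_
      rw [List.ofFn_succ]
      congr 2
      congr 1
      funext j
      by_cases h : j = i
      · subst h; simp
      · simp [Function.update_of_ne h, Function.update_of_ne fun h' => h (Fin.succ_injective _ h')]

variable {K : Type*} [Field K] [AddCommGroup A] [Module K A] [Module K M]

/-- `G` is linear in each letter of words of length `n`. -/
def IsSlotLinear (K : Type*) [Field K] [Module K A] [Module K M] (n : ℕ) (G : List A → M) : Prop :=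
  ∀ u a b v (c : K), (u ++ a :: v).length = n →
    G (u ++ (c • a + b) :: v) = c • G (u ++ a :: v) + G (u ++ b :: v)

theorem IsSlotLinear.cons {n : ℕ} {G : List A → M} (h : IsSlotLinear K (n + 1) G) (a : A) :
    IsSlotLinear K n fun l => G (a :: l) := fun u b b' v c hl =>
  h (a :: u) b b' v c (by simpa using hl)

theorem leibnizSum_smul_add {f g h : A → A} {G : List A → M} {l : List A} {c : K}
    (hf : ∀ a, f a = c • g a + h a) (hG : IsSlotLinear K l.length G) :
    leibnizSum f G l = c • leibnizSum g G l + leibnizSum h G l := by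
  induction l generalizing G with
  | nil => simp [leibnizSum]
  | cons a l ih =>
    simp only [leibnizSum, ih (hG.cons a), hf]
    have := hG [] (g a) (h a) l c (by simp)
    simp only [List.nil_append] at this
    rw [this]
    module

theorem leibnizSum_add_fun {f g h : A → A} {G : List A → M} {l : List A}
    (hf : ∀ a, f a = g a + h a) (hG : IsSlotLinear K l.length G) :
    leibnizSum f G l = leibnizSum g G l + leibnizSum h G l := by
  have := leibnizSum_smul_add (c := (1 : K)) (by simpa using hf) hG
  simpa using this

/-- The commutator of two Leibniz sums. -/
theorem leibnizSum_comm {f g h : A → A} {G : List A → M} {l : List A}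
    (hf : ∀ a, g (f a) = f (g a) + h a) (hG : IsSlotLinear K l.length G) :
    leibnizSum f (leibnizSum g G) l = leibnizSum g (leibnizSum f G) l + leibnizSum h G l := by
  induction l generalizing G with
  | nil => simp [leibnizSum]
  | cons a l ih =>
    simp only [leibnizSum, leibnizSum_add, hf]
    have h1 := hG [] (f (g a)) (h a) l 1 (by simp)
    simp only [List.nil_append, one_smul] at h1
    have h2 := ih (hG.cons a)
    rw [h1]
    have h3 : ∀ f g : A → A, leibnizSum f (fun l' => leibnizSum g (fun l'' => G (a :: l'')) l') l =
      leibnizSum f (leibnizSum g fun l'' => G (a :: l'')) l := fun _ _ => rfl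
    rw [h3, h3, h2]
    abel

end LeibnizSums

/-! ### The action of words -/

section Words

variable {A : Type*} [NonUnitalNonAssocRing A]

/-- Auxiliary recursion for `wordAct`. -/
def wordActAux : ℕ → List A → A → A
  -- The recursion runs on the length because the words in the Leibniz sum are as long as the tail,
  -- but are not themselves tails.
  | 0, _, r => r
  | _ + 1, [], r => r
  | n + 1, z :: l, r =>
    z * wordActAux n l r - leibnizSum (fun a => z * a) (fun l' => wordActAux n l' r) l

/-- The action of a word on an element of the algebra. -/
def wordAct (l : List A) (r : A) : A := wordActAux l.length l r

@[simp] theorem wordAct_nil (r : A) : wordAct [] r = r := rfl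

theorem wordAct_cons (z : A) (l : List A) (r : A) :
    wordAct (z :: l) r =
      z * wordAct l r - leibnizSum (fun a => z * a) (fun l' => wordAct l' r) l := by
  rw [wordAct, List.length_cons, wordActAux]
  congr 1
  exact leibnizSum_congr fun l' hl' => by rw [wordAct, hl']

theorem graft_eq_wordAct (k : ℕ) (x : Fin k → A) (r : A) :
    graft k x r = wordAct (List.ofFn x) r := by
  induction k with
  | zero => rfl
  | succ k ih =>
    rw [graft, List.ofFn_succ, wordAct_cons, ih, leibnizSum_ofFn]
    simp only [ih]

variable {K : Type*} [Field K] [Module K A] [IsScalarTower K A A] [SMulCommClass K A A]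

theorem isSlotLinear_wordAct (r : A) (n : ℕ) : IsSlotLinear K n fun l => wordAct l r := by
  induction n with
  | zero => intro u a b v c h; simp at h
  | succ n ih =>
    intro u a b v c h
    cases u with
    | nil =>
      have hv : v.length = n := by simpa using h
      simp only [List.nil_append, wordAct_cons]
      rw [leibnizSum_smul_add (c := c) (fun x => by rw [add_mul, smul_mul_assoc]) (hv ▸ ih),
        add_mul, smul_mul_assoc]
      module
    | cons z u =>
      have hl : (u ++ a :: v).length = n := by simpa using h
      simp only [List.cons_append, wordAct_cons, leibnizSum_append, leibnizSum]
      have ih' : ∀ u a b v (c : K), (u ++ a :: v).length = n → wordAct (u ++ (c • a + b) :: v) r =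
        c • wordAct (u ++ a :: v) r + wordAct (u ++ b :: v) r := ih
      rw [ih' u a b v c hl, mul_add z (c • a), mul_smul_comm, ih' u _ _ v c (by simpa using hl),
        leibnizSum_congr (G' := fun u' => c • wordAct (u' ++ a :: v) r + wordAct (u' ++ b :: v) r)
          fun u' hu' => ih u' a b v c (by simpa [hu'] using hl),
        leibnizSum_congr (l := v)
          (G' := fun v' => c • wordAct (u ++ a :: v') r + wordAct (u ++ b :: v') r)
          fun v' hv' => ih u a b v' c (by simpa [hv'] using hl),
        leibnizSum_add, leibnizSum_add, ← smul_leibnizSum, ← smul_leibnizSum, mul_add,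
        mul_smul_comm]
      module

theorem IsSlotLinear.wordAct_append (u : List A) (r : A) (n : ℕ) :
    IsSlotLinear K n fun l => wordAct (u ++ l) r := fun w a b v c _ => by
  have := isSlotLinear_wordAct (K := K) r (u ++ w ++ a :: v).length (u ++ w) a b v c rfl
  simpa using this

/-- A derivation acts on words by the Leibniz rule. -/
theorem derivation_wordAct (D : A →ₗ[K] A) (hD : ∀ a b, D (a * b) = D a * b + a * D b)
    (l : List A) (r : A) :
    D (wordAct l r) = leibnizSum D (fun l' => wordAct l' r) l + wordAct l (D r) := by
  induction hn : l.length generalizing l with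
  | zero =>
    rw [List.length_eq_zero_iff] at hn
    subst hn
    simp [leibnizSum]
  | succ n ih =>
    obtain _ | ⟨z, l⟩ := l
    · simp at hn
    have hl : l.length = n := by simpa using hn
    have h1 := leibnizSum_comm (K := K) (f := fun a => z * a) (g := D) (h := fun a => D z * a)
      (fun a => by rw [hD, add_comm]) (isSlotLinear_wordAct r l.length)
    rw [leibnizSum, wordAct_cons, wordAct_cons, wordAct_cons, map_sub, hD, ih l hl,
      map_leibnizSum D,
      leibnizSum_congr (G' := fun l' => leibnizSum D (fun l' => wordAct l' r) l' + wordAct l' (D r))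
        (fun l' hl' => ih l' (hl'.trans hl)), leibnizSum_add]
    simp only [wordAct_cons, leibnizSum_sub]
    rw [← mul_leibnizSum]
    have h2 : leibnizSum (fun a => z * a) (fun l' => leibnizSum D (fun l' => wordAct l' r) l') l =
      leibnizSum (fun a => z * a) (leibnizSum D fun l' => wordAct l' r) l := rfl
    have h3 : leibnizSum D (fun l' => leibnizSum (fun a => z * a) (fun l' => wordAct l' r) l') l =
      leibnizSum D (leibnizSum (fun a => z * a) fun l' => wordAct l' r) l := rfl
    rw [h2, h3, h1, mul_add]
    abel

end Words

/-! ### Reordering words modulo triple brackets -/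

section TripleWords

variable {K A : Type*} [Field K] [NonUnitalNonAssocRing A] [Module K A] [IsScalarTower K A A]
  [SMulCommClass K A A]

/-- The triple bracket as an additive map in its last argument. -/
def tripleHom (x y : A) : A →+ A where
  toFun := triple x y
  map_zero' := by simp [triple, ass]
  map_add' a b := by simp only [triple, ass, mul_add]; abel

theorem tripleHom_apply (x y z : A) : tripleHom x y z = triple x y z := rfl

/-- Exchanging two neighbouring letters of a word. -/
theorem wordAct_swap (K : Type*) {A : Type*} [Field K] [NonUnitalNonAssocRing A] [Module K A]
    [IsScalarTower K A A] [SMulCommClass K A A]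
    (hA : ∀ w x y z : A, w * triple x y z =
      triple (w * x) y z + triple x (w * y) z + triple x y (w * z))
    (u : List A) (x y : A) (v : List A) (r : A) :
    wordAct (u ++ x :: y :: v) r - wordAct (u ++ y :: x :: v) r =
      tripleHom x y (wordAct (u ++ v) r) -
        leibnizSum (tripleHom x y) (fun v' => wordAct (u ++ v') r) v := by
  induction hn : u.length generalizing u x y v with
  | zero =>
    rw [List.length_eq_zero_iff] at hn
    subst hn
    -- With x and y in front, both the action on the remaining word and the action on its letters
    -- involve the operator x(y·) - (xy)· - y(x·) + (yx)·, which is [x, y, ·].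
    have hlin := isSlotLinear_wordAct (K := K) r v.length
    have h1 := leibnizSum_comm (f := fun a => x * a) (g := fun a => y * a)
      (h := fun a => y * (x * a) - x * (y * a)) (fun a => by abel) hlin
    have h2 := leibnizSum_add_fun (f := fun a => (y * x) * a)
      (g := fun a => tripleHom x y a + (y * (x * a) - x * (y * a))) (h := fun a => (x * y) * a)
      (fun a => by simp only [tripleHom_apply, triple, ass]; abel) hlin
    have h3 := leibnizSum_add_fun (f := fun a => tripleHom x y a + (y * (x * a) - x * (y * a)))
      (g := tripleHom x y) (h := fun a => y * (x * a) - x * (y * a)) (fun a => rfl) hlin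
    have h4 : ∀ f g : A → A, leibnizSum f (fun l' => leibnizSum g (fun l' => wordAct l' r) l') v =
      leibnizSum f (leibnizSum g fun l' => wordAct l' r) v := fun f g => rfl
    simp only [List.nil_append, wordAct_cons, leibnizSum, leibnizSum_sub, mul_sub]
    rw [← mul_leibnizSum, ← mul_leibnizSum, h4, h4, h1, h2, h3]
    simp only [tripleHom_apply, triple, ass]
    abel
  | succ n ih =>
    obtain _ | ⟨z, u⟩ := u
    · simp at hn
    have hu : u.length = n := by simpa using hn
    have hlin := IsSlotLinear.wordAct_append (K := K) u r v.length
    have h1 := leibnizSum_comm (f := tripleHom x y) (g := fun a => z * a)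
      (h := fun a => tripleHom (z * x) y a + tripleHom x (z * y) a)
      (fun a => by simp only [tripleHom_apply, hA]; abel) hlin
    have h2 := leibnizSum_add_fun (f := fun a => tripleHom (z * x) y a + tripleHom x (z * y) a)
      (g := tripleHom (z * x) y) (h := tripleHom x (z * y)) (fun a => rfl) hlin
    have hE : ∀ x y : A, wordAct (z :: u ++ x :: y :: v) r =
        z * wordAct (u ++ x :: y :: v) r -
          (leibnizSum (fun a => z * a) (fun u' => wordAct (u' ++ x :: y :: v) r) u +
            (wordAct (u ++ (z * x) :: y :: v) r + (wordAct (u ++ x :: (z * y) :: v) r +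
              leibnizSum (fun a => z * a) (fun v' => wordAct (u ++ x :: y :: v') r) v))) := by
      intro x y
      rw [List.cons_append, wordAct_cons, leibnizSum_append]
      rfl
    have hu1 : leibnizSum (fun a => z * a) (fun u' => wordAct (u' ++ x :: y :: v) r) u -
        leibnizSum (fun a => z * a) (fun u' => wordAct (u' ++ y :: x :: v) r) u =
        tripleHom x y (leibnizSum (fun a => z * a) (fun u' => wordAct (u' ++ v) r) u) -
          leibnizSum (tripleHom x y) (fun v' => leibnizSum (fun a => z * a)
            (fun u' => wordAct (u' ++ v') r) u) v := by
      rw [← leibnizSum_sub, leibnizSum_congr fun u' hu' => ih u' x y v (hu'.trans hu),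
        leibnizSum_sub, map_leibnizSum (tripleHom x y), leibnizSum_leibnizSum]
    have hv1 : leibnizSum (fun a => z * a) (fun v' => wordAct (u ++ x :: y :: v') r) v -
        leibnizSum (fun a => z * a) (fun v' => wordAct (u ++ y :: x :: v') r) v =
        tripleHom x y (leibnizSum (fun a => z * a) (fun v' => wordAct (u ++ v') r) v) -
          leibnizSum (fun a => z * a)
            (leibnizSum (tripleHom x y) fun v' => wordAct (u ++ v') r) v := by
      rw [← leibnizSum_sub, leibnizSum_congr fun v' _ => ih u x y v' hu, leibnizSum_sub,
        map_leibnizSum (tripleHom x y)]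
    have hx := ih u (z * x) y v hu
    have hy := ih u x (z * y) v hu
    have h0 := congrArg (fun a => z * a) (ih u x y v hu)
    simp only [mul_sub] at h0
    -- Moving `z` past [x, y, ·] creates [zx, y, ·] and [x, zy, ·]. They match the exchanges in the
    -- words in which `z` has acted on one of the two exchanged letters.
    have hz : z * tripleHom x y (wordAct (u ++ v) r) = tripleHom (z * x) y (wordAct (u ++ v) r) +
        tripleHom x (z * y) (wordAct (u ++ v) r) + tripleHom x y (z * wordAct (u ++ v) r) :=
      hA _ _ _ _
    have hR : leibnizSum (tripleHom x y) (fun v' => wordAct (z :: u ++ v') r) v =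
        z * leibnizSum (tripleHom x y) (fun v' => wordAct (u ++ v') r) v -
        (leibnizSum (tripleHom x y) (fun v' => leibnizSum (fun a => z * a)
            (fun u' => wordAct (u' ++ v') r) u) v +
          leibnizSum (tripleHom x y)
            (leibnizSum (fun a => z * a) fun v' => wordAct (u ++ v') r) v) := by
      simp only [List.cons_append, wordAct_cons, leibnizSum_append, leibnizSum_sub, leibnizSum_add]
      rw [← mul_leibnizSum]
    rw [hE, hE, hR, List.cons_append, wordAct_cons, leibnizSum_append, map_sub, map_add, h1, h2]
    rw [hz] at h0
    linear_combination (norm := module) h0 - hu1 - hx - hy - hv1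

variable [CharZero K] {W : Submodule K A} (hW : ∀ x ∈ W, ∀ y ∈ W, ∀ z ∈ W, triple x y z ∈ W)
  (hA : ∀ w x y z : A, w * triple x y z =
      triple (w * x) y z + triple x (w * y) z + triple x y (w * z))

include hW hA

omit [CharZero K] in
-- By `wordAct_swap` an exchange costs triple brackets with shorter words and shorter words with
-- bracketed letters, all in `W` by assumption on smaller lengths.
theorem wordAct_sub_mem_of_perm {r : A} {n : ℕ}
    (hn : ∀ l : List A, l.length < n → (∀ a ∈ l, a ∈ W) → wordAct l r ∈ W) {l l' : List A}
    (hl : l.Perm l') : ∀ u : List A, (u ++ l).length = n → (∀ a ∈ u ++ l, a ∈ W) →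
      wordAct (u ++ l) r - wordAct (u ++ l') r ∈ W := by
  induction hl with
  | nil => intro u _ _; simp
  | @cons a l l' _ ih =>
    intro u h1 h2
    simpa using ih (u ++ [a]) (by simpa using h1) (by simpa using h2)
  | swap x y v =>
    intro u h1 h2
    have hu : ∀ a ∈ u, a ∈ W := fun a ha => h2 a (by simp [ha])
    have hv : ∀ a ∈ v, a ∈ W := fun a ha => h2 a (by simp [ha])
    have hx : x ∈ W := h2 x (by simp)
    have hy : y ∈ W := h2 y (by simp)
    simp only [List.length_append, List.length_cons] at h1
    rw [wordAct_swap K hA]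
    refine sub_mem (hW _ hy _ hx _ (hn _ (by simp; omega) ?_))
      (leibnizSum_mem W (p := fun a => a ∈ W) (fun a ha => hW _ hy _ hx _ (hv a ha)) hv
        fun v' hv' hp => hn _ (by simp; omega) ?_)
    · intro a ha
      rcases List.mem_append.1 ha with ha | ha
      exacts [hu a ha, hv a ha]
    · intro a ha
      rcases List.mem_append.1 ha with ha | ha
      exacts [hu a ha, hp a ha]
  | trans hp hq ih1 ih2 =>
    intro u h1 h2
    have h3 := hp.append_left u
    have := add_mem (ih1 u h1 h2)
      (ih2 u (h3.length_eq ▸ h1) fun a ha => h2 a (h3.mem_iff.2 ha))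
    simpa using this

/-- If a subspace `W` is closed under triple brackets and contains the symmetrised words in a
spanning set of letters, then it contains all words with letters in `W`. -/
theorem wordAct_mem {r : A} {T : Set A} (hT : W = Submodule.span K T)
    (hsym : ∀ k (b : Fin k → A), (∀ i, b i ∈ T) →
      ∑ σ : Equiv.Perm (Fin k), graft k (fun i => b (σ i)) r ∈ W)
    (l : List A) (hl : ∀ a ∈ l, a ∈ W) : wordAct l r ∈ W := by
  induction hn : l.length using Nat.strong_induction_on generalizing l with
  | _ n ih =>
    have ih' : ∀ l : List A, l.length < n → (∀ a ∈ l, a ∈ W) → wordAct l r ∈ W :=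
      fun l h1 h2 => ih _ h1 l h2 rfl
    have hTW : T ⊆ W := hT ▸ Submodule.subset_span
    -- Modulo `W`, n! times the word equals the sum over all its orderings, and n! is invertible.
    have hbase : ∀ l : List A, l.length = n → (∀ a ∈ l, a ∈ T) → wordAct l r ∈ W := by
      intro l hl1 hl2
      have h1 := hsym l.length l.get fun i => hl2 _ (List.get_mem _ _)
      have h2 : ∀ σ : Equiv.Perm (Fin l.length),
          wordAct l r - graft l.length (fun i => l.get (σ i)) r ∈ W := by
        intro σ
        have hp : l.Perm (List.ofFn fun i => l.get (σ i)) := by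
          have := Equiv.Perm.ofFn_comp_perm σ l.get
          rw [List.ofFn_get] at this
          exact this.symm
        rw [graft_eq_wordAct]
        simpa using wordAct_sub_mem_of_perm hW hA ih' hp [] (by simpa using hl1)
          fun a ha => hTW (hl2 a (by simpa using ha))
      have h3 := add_mem (Submodule.sum_mem W fun σ (_ : σ ∈ Finset.univ) => h2 σ) h1
      rw [← Finset.sum_add_distrib] at h3
      simp only [sub_add_cancel, Finset.sum_const, Finset.card_univ, Fintype.card_perm] at h3
      rw [← Nat.cast_smul_eq_nsmul K] at h3
      exact (Submodule.smul_mem_iff W (Nat.cast_ne_zero.2 (Nat.factorial_ne_zero _))).1 h3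
    -- Linearity in each slot passes from letters in `T` to letters in its span, one letter at a
    -- time.
    have hslot : ∀ v u : List A, (u ++ v).length = n → (∀ a ∈ u, a ∈ T) → (∀ a ∈ v, a ∈ W) →
        wordAct (u ++ v) r ∈ W := by
      intro v
      induction v with
      | nil => intro u h1 h2 _; exact hbase _ h1 (by simpa using h2)
      | cons a v ihv =>
        intro u h1 h2 h3
        simp only [List.forall_mem_cons] at h3
        have h4 : ∀ a ∈ Submodule.span K T, wordAct (u ++ a :: v) r ∈ W := by
          intro a ha
          have hs := isSlotLinear_wordAct (K := K) r n
          have h0 : wordAct (u ++ 0 :: v) r = 0 := by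
            have := hs u 0 0 v 1 (by simpa using h1)
            simpa using this
          induction ha using Submodule.span_induction with
          | mem a ha =>
            have := ihv (u ++ [a]) (by simpa using h1)
              (by simp only [List.mem_append, List.mem_singleton]
                  rintro b (hb | rfl)
                  exacts [h2 b hb, ha]) h3.2
            simpa using this
          | zero => rw [h0]; exact zero_mem W
          | add a b _ _ ha hb =>
            have := hs u a b v 1 (by simpa using h1)
            simp only [one_smul] at this
            rw [this]
            exact add_mem ha hb
          | smul c a _ ha =>
            have := hs u a 0 v c (by simpa using h1)
            simp only [add_zero, h0] at this
            rw [this]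
            exact Submodule.smul_mem W c ha
        exact h4 a (hT ▸ h3.1)
    simpa using hslot l [] (by simpa using hn) (by simp) hl

end TripleWords

end LieTriple

end

noncomputable section

namespace LieTriple

open TripleMagma

/-! ### Finiteness of Hall trees of bounded grade -/

section HallTrees

variable {X : Type*} [LinearOrder (TripleMagma X)]

theorem isHall_mono {S T : Set X} (hST : S ⊆ T) {t : TripleMagma X} (h : IsHall S t) :
    IsHall T t := by
  induction h with
  | leaf hx => exact .leaf (hST hx)
  | bracket _ _ _ h1 h2 h3 hu hv hw => exact .bracket hu hv hw h1 h2 h3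

/-- Restricting to finitely many letters makes the Hall trees of bounded grade finite in number, so
that induction up the order terminates. -/
theorem TripleMagma.IsHall.exists_finite {S : Set X} {t : TripleMagma X} (h : IsHall S t) :
    ∃ F : Set X, F.Finite ∧ F ⊆ S ∧ IsHall F t := by
  induction h with
  | @leaf s hs => exact ⟨{s}, Set.finite_singleton s, by simpa using hs, .leaf rfl⟩
  | bracket _ _ _ h1 h2 h3 hu hv hw =>
    obtain ⟨F, hF, hFS, hFt⟩ := hu
    obtain ⟨G, hG, hGS, hGt⟩ := hv
    obtain ⟨H, hH, hHS, hHt⟩ := hw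
    refine ⟨F ∪ G ∪ H, (hF.union hG).union hH, by simp [hFS, hGS, hHS], ?_⟩
    exact .bracket (isHall_mono (by intro x hx; simp [hx]) hFt)
      (isHall_mono (by intro x hx; simp [hx]) hGt) (isHall_mono (by intro x hx; simp [hx]) hHt)
      h1 h2 h3

variable {ω : X → ℕ} (hω : ∀ s, 0 < ω s)

include hω in
theorem finite_isHall_grade_le {F : Set X} (hF : F.Finite) (n : ℕ) :
    {t : TripleMagma X | IsHall F t ∧ t.grade ω ≤ n}.Finite := by
  induction n with
  | zero =>
    refine Set.finite_empty.subset ?_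
    rintro t ⟨_, ht⟩
    exact absurd (grade_pos hω t) (by omega)
  | succ n ih =>
    refine ((hF.image leaf).union ((ih.prod (ih.prod ih)).image
      fun p => bracket p.1 p.2.1 p.2.2)).subset ?_
    rintro t ⟨h, ht⟩
    cases h with
    | leaf hs => exact Or.inl ⟨_, hs, rfl⟩
    | @bracket u v w hu hv hw _ _ _ =>
      simp only [TripleMagma.grade] at ht
      have h1 := grade_pos hω u
      have h2 := grade_pos hω v
      have h3 := grade_pos hω w
      refine Or.inr ⟨(u, v, w), ⟨⟨hu, ?_⟩, ⟨hv, ?_⟩, ⟨hw, ?_⟩⟩, rfl⟩ <;> dsimp only <;> omega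

/-- The number of Hall trees of bounded grade above a given tree. -/
def corank (ω : X → ℕ) (F : Set X) (n : ℕ) (t : TripleMagma X) : ℕ :=
  {t' : TripleMagma X | (IsHall F t' ∧ t'.grade ω ≤ n) ∧ t < t'}.ncard

include hω in
theorem corank_lt {F : Set X} (hF : F.Finite) {n : ℕ} {t t' : TripleMagma X} (h : t < t')
    (ht' : IsHall F t') (hn : t'.grade ω ≤ n) : corank ω F n t' < corank ω F n t := by
  refine Set.ncard_lt_ncard ⟨fun s hs => ⟨hs.1, h.trans hs.2⟩, fun hs => ?_⟩
    ((finite_isHall_grade_le hω hF n).subset fun s hs => hs.1)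
  exact lt_irrefl _ (hs ⟨⟨ht', hn⟩, h⟩).2

end HallTrees

/-! ### Hall rewriting of triple brackets -/

section HallSpan

variable {X A : Type*} [NonUnitalNonAssocRing A]

/-- Evaluation of formal triple brackets at given values of the letters. -/
def evalWith (f : X → A) : TripleMagma X → A
  | leaf x => f x
  | bracket u v w => triple (evalWith f u) (evalWith f v) (evalWith f w)

theorem triple_self (x z : A) : triple x x z = 0 := by simp [triple]

theorem triple_swap (x y z : A) : triple x y z = -triple y x z := by simp [triple]

/-- The operator [a, b, ·] is a combination of left multiplications and their products. The
derivation defects of the products cancel in the antisymmetrisation, so it is itself a derivation of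
the bracket. -/
theorem triple_triple
    (hA : ∀ w x y z : A, w * triple x y z =
      triple (w * x) y z + triple x (w * y) z + triple x y (w * z)) (a b x y z : A) :
    triple a b (triple x y z) =
      triple (triple a b x) y z + triple x (triple a b y) z + triple x y (triple a b z) := by
  have h : ∀ t : A, triple a b t = a * (b * t) - (a * b) * t - b * (a * t) + (b * a) * t := by
    intro t; simp only [triple, ass]; abel
  have h1 : ∀ t t' y z : A, triple (t + t') y z = triple t y z + triple t' y z := by
    intro t t' y z; simp only [triple, ass, add_mul, mul_add]; abel
  have h2 : ∀ t t' y z : A, triple y (t + t') z = triple y t z + triple y t' z := by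
    intro t t' y z; simp only [triple, ass, add_mul, mul_add]; abel
  have h1' : ∀ t t' y z : A, triple (t - t') y z = triple t y z - triple t' y z := by
    intro t t' y z; simp only [triple, ass, sub_mul, mul_sub]; abel
  have h2' : ∀ t t' y z : A, triple y (t - t') z = triple y t z - triple y t' z := by
    intro t t' y z; simp only [triple, ass, sub_mul, mul_sub]; abel
  have h3 : ∀ t t' y z : A, triple y z (t + t') = triple y z t + triple y z t' := by
    intro t t' y z; simp only [triple, ass, mul_add]; abel
  have h3' : ∀ t t' y z : A, triple y z (t - t') = triple y z t - triple y z t' := by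
    intro t t' y z; simp only [triple, ass, mul_sub]; abel
  rw [h (triple x y z), h x, h y, h z]
  simp only [hA, h1, h2, h3, h1', h2', h3', mul_add]
  abel

variable {K : Type*} [Field K] [Module K A] [IsScalarTower K A A] [SMulCommClass K A A]

variable (K) in
/-- The triple bracket as a linear map in its last argument. -/
def tripleRight (x y : A) : A →ₗ[K] A where
  toFun z := triple x y z
  map_add' a b := (tripleHom x y).map_add a b
  map_smul' c a := by simp [triple, ass, smul_sub, mul_smul_comm]

variable (K) in
/-- The triple bracket as a linear map in its second argument. -/
def tripleMid (x z : A) : A →ₗ[K] A where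
  toFun y := triple x y z
  map_add' a b := by simp only [triple, ass, add_mul, mul_add]; abel
  map_smul' c a := by simp [triple, ass, smul_sub, mul_smul_comm, smul_mul_assoc]

variable [LinearOrder (TripleMagma X)]

/-- The span of the Hall brackets `[u, v, w]` of given grade with `y ≤ w`. -/
def hallSpan (K : Type*) [Field K] [Module K A] (f : X → A) (ω : X → ℕ) (F : Set X)
    (y : TripleMagma X) (n : ℕ) : Submodule K A :=
  Submodule.span K {a | ∃ u v w, IsHall F (bracket u v w) ∧ (bracket u v w).grade ω = n ∧ y ≤ w ∧
    evalWith f (bracket u v w) = a}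

omit [IsScalarTower K A A] [SMulCommClass K A A] in
theorem hallSpan_anti {f : X → A} {ω : X → ℕ} {F : Set X} {y y' : TripleMagma X} (h : y ≤ y')
    {n : ℕ} : hallSpan K f ω F y' n ≤ hallSpan K f ω F y n := by
  refine Submodule.span_mono ?_
  rintro _ ⟨u, v, w, h1, h2, h3, rfl⟩
  exact ⟨u, v, w, h1, h2, h.trans h3, rfl⟩

variable {ω : X → ℕ} (hω : ∀ s, 0 < ω s)
  (hlt : ∀ u v : TripleMagma X, u.grade ω < v.grade ω → u < v)

include hω hlt

omit [IsScalarTower K A A] [SMulCommClass K A A] in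
theorem map_mem_of_mem_hallSpan {f : X → A} {F : Set X} {y : TripleMagma X} {n : ℕ}
    {N : Submodule K A} (φ : A →ₗ[K] A)
    (h : ∀ g, IsHall F g → g.grade ω = n → y < g → φ (evalWith f g) ∈ N) {a : A}
    (ha : a ∈ hallSpan K f ω F y n) : φ a ∈ N := by
  have : hallSpan K f ω F y n ≤ N.comap φ := by
    refine Submodule.span_le.2 ?_
    rintro _ ⟨u, v, w, h1, h2, h3, rfl⟩
    exact h _ h1 h2 (h3.trans_lt (lt_bracket_right hω hlt u v w))
  exact this ha

variable (hA : ∀ w x y z : A, w * triple x y z =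
      triple (w * x) y z + triple x (w * y) z + triple x y (w * z))
  (hJ : ∀ x y z : A, triple x y z + triple y z x + triple z x y = 0)

include hA hJ

/-- Rewriting terminates by induction on the grade, then upwards on the last entry `w`, then upwards
on the smaller of `p` and `q`. Keeping track of the last entry is essential: a Hall bracket exceeds
its last entry, so expanding an inner bracket strictly raises the corresponding entry. -/
theorem triple_mem_hallSpan (f : X → A) {F : Set X} (hF : F.Finite) (n : ℕ) :
    ∀ p q w : TripleMagma X, IsHall F p → IsHall F q → IsHall F w →
      p.grade ω + q.grade ω + w.grade ω = n →
        triple (evalWith f p) (evalWith f q) (evalWith f w) ∈ hallSpan K f ω F w n := by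
  induction n using Nat.strong_induction_on with
  | _ n ihn =>
  intro p q w hp hq hw hn
  induction h1 : corank ω F n w using Nat.strong_induction_on generalizing p q w with
  | _ m1 ih1 =>
  induction h2 : corank ω F n (min p q) using Nat.strong_induction_on generalizing p q with
  | _ m2 ih2 =>
  subst h1 h2
  have gp := grade_pos hω p
  have gq := grade_pos hω q
  have gw := grade_pos hω w
  suffices key : ∀ p q : TripleMagma X, IsHall F p → IsHall F q →
      p.grade ω + q.grade ω + w.grade ω = n → q < p →
      (∀ p' q', IsHall F p' → IsHall F q' → p'.grade ω + q'.grade ω + w.grade ω = n →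
        q < min p' q' →
        triple (evalWith f p') (evalWith f q') (evalWith f w) ∈ hallSpan K f ω F w n) →
      triple (evalWith f p) (evalWith f q) (evalWith f w) ∈ hallSpan K f ω F w n by
    have ih2' : ∀ p' q', IsHall F p' → IsHall F q' → p'.grade ω + q'.grade ω + w.grade ω = n →
        min p q < min p' q' →
        triple (evalWith f p') (evalWith f q') (evalWith f w) ∈ hallSpan K f ω F w n := by
      intro p' q' hp' hq' hn' hlt'
      refine ih2 _ (corank_lt hω hF hlt' ?_ ?_) p' q' hp' hq' hn' rfl
      · rcases min_choice p' q' with h | h <;> rw [h] <;> assumption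
      · rcases min_choice p' q' with h | h <;> rw [h] <;> omega
    rcases lt_trichotomy q p with h | rfl | h
    · exact key p q hp hq hn h (by rwa [min_eq_right h.le] at ih2')
    · rw [triple_self]; exact zero_mem _
    · rw [triple_swap]
      exact neg_mem (key q p hq hp (by omega) h (by rwa [min_eq_left h.le] at ih2'))
  intro p q hp hq hn hqp ih
  have gp := grade_pos hω p
  have gq := grade_pos hω q
  have up : ∀ g : TripleMagma X, IsHall F g → g.grade ω ≤ n → w < g → ∀ p q : TripleMagma X,
      IsHall F p → IsHall F q → p.grade ω + q.grade ω + g.grade ω = n →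
      triple (evalWith f p) (evalWith f q) (evalWith f g) ∈ hallSpan K f ω F w n :=
    fun g hg hgn hwg p q hp hq hn =>
      hallSpan_anti hwg.le (ih1 _ (corank_lt hω hF hwg hg hgn) p q g hp hq hg hn rfl)
  rcases lt_or_ge w q with hwq | hqw
  -- If w < q < p, the Jacobi identity moves `w` out of the last place and the last entry grows.
  · have h3 : triple (evalWith f p) (evalWith f q) (evalWith f w) =
        triple (evalWith f p) (evalWith f w) (evalWith f q) -
          triple (evalWith f q) (evalWith f w) (evalWith f p) := by
      have := hJ (evalWith f p) (evalWith f q) (evalWith f w)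
      rw [triple_swap (evalWith f w) (evalWith f p)] at this
      rw [← sub_eq_zero, ← this]
      abel
    rw [h3]
    exact sub_mem (up q hq (by omega) hwq p w hp hw (by omega))
      (up p hp (by omega) (hwq.trans hqp) q w hq hw (by omega))
  by_cases hl : LastLE p q
  · exact Submodule.subset_span
      ⟨p, q, w, .bracket hp hq hw hqp hqw hl, hn, le_rfl, rfl⟩
  cases hp with
  | leaf hs => exact absurd trivial hl
  | @bracket a b c ha hb hc _ _ _ =>
    have hqc : q < c := not_le.1 hl
    simp only [TripleMagma.grade] at hn gp
    have ga := grade_pos hω a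
    have gb := grade_pos hω b
    have gc := grade_pos hω c
    -- If p = [a, b, c] with q < c, then [p, q, w] = [a, b, [c, q, w]] - [c, [a, b, q], w] - [c, q,
    -- [a, b, w]]. Expanding the inner brackets raises the last entry in the first and third terms;
    -- in the second the first two entries become larger than `q`.
    have h3 : triple (evalWith f (bracket a b c)) (evalWith f q) (evalWith f w) =
        tripleRight K (evalWith f a) (evalWith f b)
            (triple (evalWith f c) (evalWith f q) (evalWith f w)) -
          tripleMid K (evalWith f c) (evalWith f w)
            (triple (evalWith f a) (evalWith f b) (evalWith f q)) -
          tripleRight K (evalWith f c) (evalWith f q)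
            (triple (evalWith f a) (evalWith f b) (evalWith f w)) := by
      have := triple_triple hA (evalWith f a) (evalWith f b) (evalWith f c) (evalWith f q)
        (evalWith f w)
      change triple (triple _ _ _) _ _ = triple _ _ _ - triple _ _ _ - triple _ _ _
      rw [this]
      abel
    rw [h3]
    refine sub_mem (sub_mem ?_ ?_) ?_
    · refine map_mem_of_mem_hallSpan hω hlt _ (fun g hg hgn hwg => ?_)
        (ihn (c.grade ω + q.grade ω + w.grade ω) (by omega) c q w hc hq hw rfl)
      exact up g hg (by omega) hwg a b ha hb (by omega)
    · refine map_mem_of_mem_hallSpan hω hlt _ (fun g hg hgn hqg => ?_)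
        (ihn (a.grade ω + b.grade ω + q.grade ω) (by omega) a b q ha hb hq rfl)
      exact ih c g hc hg (by omega) (lt_min hqc hqg)
    · refine map_mem_of_mem_hallSpan hω hlt _ (fun g hg hgn hwg => ?_)
        (ihn (a.grade ω + b.grade ω + w.grade ω) (by omega) a b w ha hb hw rfl)
      exact up g hg (by omega) hwg c q hc hq (by omega)

/-- The span of the Hall triple brackets is closed under the triple bracket. -/
theorem triple_mem_span_isHall (f : X → A) {S : Set X} {p q w : TripleMagma X}
    (hp : IsHall S p) (hq : IsHall S q) (hw : IsHall S w) :
    triple (evalWith f p) (evalWith f q) (evalWith f w) ∈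
      Submodule.span K (evalWith f '' {h | IsHall S h}) := by
  obtain ⟨F, hF, hFS, hFt⟩ := hp.exists_finite
  obtain ⟨G, hG, hGS, hGt⟩ := hq.exists_finite
  obtain ⟨H, hH, hHS, hHt⟩ := hw.exists_finite
  have := triple_mem_hallSpan (K := K) hω hlt hA hJ f ((hF.union hG).union hH) _ p q w
    (isHall_mono (by intro x hx; simp [hx]) hFt) (isHall_mono (by intro x hx; simp [hx]) hGt)
    (isHall_mono (by intro x hx; simp [hx]) hHt) rfl
  refine Submodule.span_mono ?_ this
  rintro _ ⟨u, v, t, h, _, _, rfl⟩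
  exact ⟨_, isHall_mono (by simp [hFS, hGS, hHS]) h, rfl⟩

end HallSpan

end LieTriple

end

noncomputable section

namespace LieTriple

open TensorProduct

/-! ### The algebra of vector fields and its identities -/

section FieldAlgebra

variable (K X : Type*) [Field K]

/-- Functions on the group with values in its Lie algebra, with the product
`(f ▷ g)(u) = ∑ g(u₁ f(u₂))`, the derivative of `g` along `f`. -/
def VectorFunction : Type _ := FreeAlgebra K X →ₗ[K] FreeAlgebra K X

namespace VectorFunction

instance : AddCommGroup (VectorFunction K X) :=
  inferInstanceAs (AddCommGroup (FreeAlgebra K X →ₗ[K] FreeAlgebra K X))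

instance : Module K (VectorFunction K X) :=
  inferInstanceAs (Module K (FreeAlgebra K X →ₗ[K] FreeAlgebra K X))

instance : FunLike (VectorFunction K X) (FreeAlgebra K X) (FreeAlgebra K X) :=
  inferInstanceAs (FunLike (FreeAlgebra K X →ₗ[K] FreeAlgebra K X) _ _)

instance : LinearMapClass (VectorFunction K X) K (FreeAlgebra K X) (FreeAlgebra K X) :=
  inferInstanceAs (LinearMapClass (FreeAlgebra K X →ₗ[K] FreeAlgebra K X) K _ _)

variable {K X}

@[ext] theorem ext {f g : VectorFunction K X} (h : ∀ u, f u = g u) : f = g := LinearMap.ext h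

@[simp] theorem add_apply (f g : VectorFunction K X) (u : FreeAlgebra K X) :
    (f + g) u = f u + g u := rfl

@[simp] theorem zero_apply (u : FreeAlgebra K X) : (0 : VectorFunction K X) u = 0 := rfl

@[simp] theorem smul_apply (c : K) (f : VectorFunction K X) (u : FreeAlgebra K X) :
    (c • f) u = c • f u := rfl

/-- The map `a ⊗ b ↦ g (a * f b)`. -/
def mulAux (f g : VectorFunction K X) :
    FreeAlgebra K X ⊗[K] FreeAlgebra K X →ₗ[K] FreeAlgebra K X :=
  TensorProduct.lift (((LinearMap.mul K (FreeAlgebra K X)).compl₂ f).compr₂ g)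

theorem mulAux_tmul (f g : VectorFunction K X) (a b : FreeAlgebra K X) :
    mulAux f g (a ⊗ₜ b) = g (a * f b) := rfl

instance : Mul (VectorFunction K X) where
  mul f g := mulAux f g ∘ₗ (freeCoprod K X).toLinearMap

theorem mul_apply (f g : VectorFunction K X) (u : FreeAlgebra K X) :
    (f * g) u = mulAux f g (freeCoprod K X u) := rfl

theorem mulAux_eq_add {f g f' g' f'' g'' : VectorFunction K X}
    (h : ∀ a b, g (a * f b) = g' (a * f' b) + g'' (a * f'' b))
    (t : FreeAlgebra K X ⊗[K] FreeAlgebra K X) :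
    mulAux f g t = mulAux f' g' t + mulAux f'' g'' t := by
  induction t using TensorProduct.induction_on with
  | zero => simp
  | tmul a b => exact h a b
  | add s t hs ht => simp only [map_add, hs, ht]; abel

theorem mulAux_eq_smul {f g f' g' : VectorFunction K X} {c : K}
    (h : ∀ a b, g (a * f b) = c • g' (a * f' b))
    (t : FreeAlgebra K X ⊗[K] FreeAlgebra K X) : mulAux f g t = c • mulAux f' g' t := by
  induction t using TensorProduct.induction_on with
  | zero => simp
  | tmul a b => exact h a b
  | add s t hs ht => simp only [map_add, hs, ht, smul_add]

instance : NonUnitalNonAssocRing (VectorFunction K X) where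
  left_distrib f g k := ext fun _ =>
    mulAux_eq_add (f := f) (g := g + k) (f' := f) (g' := g) (f'' := f) (g'' := k)
      (fun _ _ => rfl) _
  right_distrib f g k := ext fun _ =>
    mulAux_eq_add (f := f + g) (g := k) (f' := f) (g' := k) (f'' := g) (g'' := k)
      (fun a b => by rw [add_apply, mul_add, map_add]) _
  zero_mul f := ext fun u => by
    have := mulAux_eq_smul (f := 0) (g := f) (f' := 0) (g' := f) (c := (0 : K))
      (fun a b => by simp) (freeCoprod K X u)
    simpa [mul_apply] using this
  mul_zero f := ext fun u => by
    have := mulAux_eq_smul (f := f) (g := 0) (f' := f) (g' := 0) (c := (0 : K))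
      (fun a b => by simp) (freeCoprod K X u)
    simpa [mul_apply] using this

instance : IsScalarTower K (VectorFunction K X) (VectorFunction K X) where
  smul_assoc c f g := ext fun _ =>
    mulAux_eq_smul (f := c • f) (g := g) (f' := f) (g' := g)
      (fun a b => by rw [smul_apply, mul_smul_comm, map_smul]) _

instance : SMulCommClass K (VectorFunction K X) (VectorFunction K X) where
  smul_comm c f g := ext fun _ =>
    (mulAux_eq_smul (f := f) (g := c • g) (f' := f) (g' := g) (fun _ _ => rfl) _).symm

theorem mul_apply_one (f g : VectorFunction K X) : (f * g) 1 = g (f 1) := by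
  rw [mul_apply, map_one, Algebra.TensorProduct.one_def, mulAux_tmul, one_mul]

/-- Left translation by an element. -/
def translate (x : FreeAlgebra K X) : VectorFunction K X →ₗ[K] VectorFunction K X where
  toFun f := LinearMap.comp f (LinearMap.mulLeft K x)
  map_add' _ _ := rfl
  map_smul' _ _ := rfl

theorem translate_apply (x : FreeAlgebra K X) (f : VectorFunction K X) (u : FreeAlgebra K X) :
    translate x f u = f (x * u) := rfl

/-- Since `x` is primitive, it goes either into u₁ or into u₂ in ∑ g(u₁ f(u₂)). -/
theorem translate_mul {x : FreeAlgebra K X} (hx : x ∈ lieLike K X) (f g : VectorFunction K X) :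
    translate x (f * g) = translate x f * g + f * translate x g := by
  ext u
  rw [translate_apply, add_apply, mul_apply, mul_apply, mul_apply, map_mul, hx.1]
  induction freeCoprod K X u using TensorProduct.induction_on with
  | zero => simp
  | tmul a b =>
    rw [add_mul, Algebra.TensorProduct.tmul_mul_tmul, Algebra.TensorProduct.tmul_mul_tmul, map_add,
      mulAux_tmul, mulAux_tmul, mulAux_tmul, mulAux_tmul, translate_apply, translate_apply, one_mul,
      one_mul, mul_assoc, add_comm]
  | add s t hs ht => rw [mul_add, map_add, map_add, map_add, hs, ht]; abel

theorem mul_apply_lieLike {x : FreeAlgebra K X} (hx : x ∈ lieLike K X) (f g : VectorFunction K X) :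
    (f * g) x = g (f x) + g (x * f 1) := by
  have := congrArg (fun k : VectorFunction K X => k 1) (translate_mul hx f g)
  simpa [translate_apply, mul_apply_one] using this

end VectorFunction

variable {K X}

/-- Induction on the free associative algebra by multiplication with letters from the left. -/
theorem freeAlgebra_left_induction {p : FreeAlgebra K X → Prop} (one : p 1)
    (add : ∀ a b, p a → p b → p (a + b)) (smul : ∀ (c : K) a, p a → p (c • a))
    (ι_mul : ∀ x a, p a → p (FreeAlgebra.ι K x * a)) (u : FreeAlgebra K X) : p u := by
  have h : ∀ v, p v → p (u * v) := by
    induction u using FreeAlgebra.induction with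
    | grade0 r => intro v hv; rw [← Algebra.smul_def]; exact smul r v hv
    | grade1 x => exact ι_mul x
    | mul a b ha hb => intro v hv; rw [mul_assoc]; exact ha _ (hb v hv)
    | add a b ha hb => intro v hv; rw [add_mul]; exact add _ _ (ha v hv) (hb v hv)
  simpa using h 1 one

/-- A vector field on the symmetric space, as a function on the group: it has values in the odd
part and is equivariant for the even part. -/
def IsVectorField (f : VectorFunction K X) : Prop :=
  ∀ u, f u ∈ oddPart K X ∧ ∀ x ∈ oddPart K X, ∀ y ∈ oddPart K X, f (u * ⁅x, y⁆) = ⁅f u, ⁅x, y⁆⁆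

theorem add_lie_even (a b c : FreeAlgebra K X) : ⁅a, c⁆ + ⁅b, c⁆ = ⁅a + b, c⁆ := by
  simp only [Ring.lie_def]
  noncomm_ring

theorem smul_lie_even (r : K) (a c : FreeAlgebra K X) : r • ⁅a, c⁆ = ⁅r • a, c⁆ := by
  simp only [Ring.lie_def, smul_sub, smul_mul_assoc, mul_smul_comm]

open VectorFunction

theorem IsVectorField.translate {f : VectorFunction K X} (hf : IsVectorField f) (x : FreeAlgebra K X) :
    IsVectorField (translate x f) := fun u =>
  ⟨(hf (x * u)).1, fun y hy z hz => by
    have := (hf (x * u)).2 y hy z hz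
    rwa [mul_assoc] at this⟩

theorem IsVectorField.mul {f g : VectorFunction K X} (hf : IsVectorField f) (hg : IsVectorField g) :
    IsVectorField (f * g : VectorFunction K X) := by
  have hι : ∀ x, FreeAlgebra.ι K x ∈ lieLike K X := fun x => (mem_oddPart.1 (ι_mem_oddPart x)).1
  intro u
  induction u using freeAlgebra_left_induction generalizing f g with
  | one =>
    refine ⟨?_, fun x hx y hy => ?_⟩
    · rw [mul_apply_one]
      exact (hg _).1
    · have h1 := (hf 1).2 x hx y hy
      have h2 := (hg (f 1)).2 x hx y hy
      rw [one_mul] at h1 ⊢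
      -- For h = ⁅x, y⁆, equivariance of `f` gives g(f(h)) + g(h f(1)) = g(⁅f(1), h⁆ + h f(1)) =
      -- g(f(1) h), to which equivariance of `g` applies.
      rw [mul_apply_lieLike (lie_mem_lieLike (mem_oddPart.1 hx).1 (mem_oddPart.1 hy).1),
        mul_apply_one, ← map_add]
      rw [← h2, h1, Ring.lie_def (f 1), sub_add_cancel]
  | add a b ha hb =>
    have ha := ha hf hg
    have hb := hb hf hg
    refine ⟨?_, fun x hx y hy => ?_⟩
    · rw [map_add]; exact add_mem ha.1 hb.1
    · rw [add_mul, map_add, map_add, ha.2 x hx y hy, hb.2 x hx y hy, add_lie_even]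
  | smul c a ha =>
    have ha := ha hf hg
    refine ⟨?_, fun x hx y hy => ?_⟩
    · rw [map_smul]; exact Submodule.smul_mem _ _ ha.1
    · rw [smul_mul_assoc, map_smul, map_smul, ha.2 x hx y hy, smul_lie_even]
  | ι_mul x a ha =>
    have h1 := ha (hf.translate (FreeAlgebra.ι K x)) hg
    have h2 := ha hf (hg.translate (FreeAlgebra.ι K x))
    have h3 : ∀ v, (f * g) (FreeAlgebra.ι K x * v) =
        (VectorFunction.translate (FreeAlgebra.ι K x) f * g) v +
          (f * VectorFunction.translate (FreeAlgebra.ι K x) g) v := fun v => by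
      rw [← VectorFunction.translate_apply, translate_mul (hι x), VectorFunction.add_apply]
    refine ⟨?_, fun y hy z hz => ?_⟩
    · rw [h3]
      exact add_mem h1.1 h2.1
    · rw [mul_assoc, h3, h3, h1.2 y hy z hz, h2.2 y hy z hz, add_lie_even]

variable (K X) in
/-- The algebra of vector fields on the symmetric space of the free Lie triple system. -/
def fieldAlgebra : NonUnitalSubalgebra K (VectorFunction K X) where
  carrier := {f | IsVectorField f}
  add_mem' {f g} hf hg := fun u => ⟨add_mem (hf u).1 (hg u).1, fun x hx y hy => by
    rw [VectorFunction.add_apply, VectorFunction.add_apply, (hf u).2 x hx y hy,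
      (hg u).2 x hx y hy, add_lie_even]⟩
  zero_mem' := fun u => ⟨zero_mem _, fun x _ y _ => by
    rw [VectorFunction.zero_apply, VectorFunction.zero_apply]; simp [Ring.lie_def]⟩
  mul_mem' hf hg := IsVectorField.mul hf hg
  smul_mem' c f hf := fun u => ⟨Submodule.smul_mem _ c (hf u).1, fun x hx y hy => by
    rw [VectorFunction.smul_apply, VectorFunction.smul_apply, (hf u).2 x hx y hy, smul_lie_even]⟩

/-- The value of a vector field at the base point. -/
def baseValue : fieldAlgebra K X →ₗ[K] FreeAlgebra K X where
  toFun f := f.1 1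
  map_add' _ _ := rfl
  map_smul' _ _ := rfl

theorem baseValue_mem (f : fieldAlgebra K X) : baseValue f ∈ oddPart K X := (f.2 1).1

/-- Left translation of vector fields. -/
def fieldTranslate (x : FreeAlgebra K X) : fieldAlgebra K X →ₗ[K] fieldAlgebra K X where
  toFun f := ⟨translate x f.1, IsVectorField.translate f.2 x⟩
  map_add' _ _ := rfl
  map_smul' _ _ := rfl

theorem fieldTranslate_mul {x : FreeAlgebra K X} (hx : x ∈ lieLike K X) (f g : fieldAlgebra K X) :
    fieldTranslate x (f * g) = fieldTranslate x f * g + f * fieldTranslate x g :=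
  Subtype.ext (translate_mul hx f.1 g.1)

theorem baseValue_mul (f g : fieldAlgebra K X) :
    baseValue (f * g) = baseValue (fieldTranslate (baseValue f) g) := by
  change (f.1 * g.1) 1 = g.1 (f.1 1 * 1)
  rw [mul_apply_one, mul_one]

/-- The associator at the base point is k(f(1) g(1)). Its antisymmetrisation is k at the even
element ⁅f(1), g(1)⁆, where equivariance of `k` applies. -/
theorem baseValue_triple (f g k : fieldAlgebra K X) :
    baseValue (triple f g k) = ⁅baseValue k, ⁅baseValue f, baseValue g⁆⁆ := by
  have h : ∀ f g : fieldAlgebra K X,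
      baseValue (ass f g k) = k.1 (baseValue f * baseValue g) := by
    intro f g
    have h1 : baseValue (f * (g * k)) = (g.1 * k.1) (f.1 1) := mul_apply_one f.1 (g.1 * k.1)
    have h2 : baseValue (f * g * k) = k.1 ((f.1 * g.1) 1) := mul_apply_one (f.1 * g.1) k.1
    have h3 : f.1 1 ∈ lieLike K X := (mem_oddPart.1 (baseValue_mem f)).1
    rw [ass, map_sub, h1, h2, mul_apply_one, mul_apply_lieLike h3]
    change k.1 (g.1 (f.1 1)) + k.1 (f.1 1 * g.1 1) - _ = _
    rw [add_sub_cancel_left]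
    rfl
  rw [triple, map_sub, h, h, ← map_sub]
  have := (k.2 1).2 _ (baseValue_mem f) _ (baseValue_mem g)
  rw [one_mul] at this
  exact this

theorem map_triple_of_derivation {A F : Type*} [NonUnitalNonAssocRing A] [FunLike F A A]
    [AddMonoidHomClass F A A] {D : F} (hD : ∀ a b, D (a * b) = D a * b + a * D b) (x y z : A) :
    D (triple x y z) = triple (D x) y z + triple x (D y) z + triple x y (D z) := by
  simp only [triple, ass, map_sub, hD, mul_add, add_mul]
  abel

/-- A multilinear expression in vector fields vanishes if it is compatible with translation and
vanishes at the base point. -/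
theorem field_eq_zero {I : Set (fieldAlgebra K X)} (h1 : ∀ f ∈ I, baseValue f = 0)
    (h2 : ∀ x : X, ∀ f ∈ I, fieldTranslate (FreeAlgebra.ι K x) f ∈ AddSubmonoid.closure I) :
    ∀ f ∈ I, f = 0 := by
  intro f hf
  have key : ∀ u : FreeAlgebra K X, ∀ f ∈ AddSubmonoid.closure I, f.1 u = 0 := by
    intro u
    induction u using freeAlgebra_left_induction with
    | one =>
      intro f hf
      induction hf using AddSubmonoid.closure_induction with
      | mem f hf => exact h1 f hf
      | zero => rfl
      | add f g _ _ hf hg =>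
        change f.1 1 + g.1 1 = 0
        rw [hf, hg, add_zero]
    | add a b ha hb => intro f hf; rw [map_add, ha f hf, hb f hf, add_zero]
    | smul c a ha => intro f hf; rw [map_smul, ha f hf, smul_zero]
    | ι_mul x a ha =>
      intro f hf
      have : fieldTranslate (FreeAlgebra.ι K x) f ∈ AddSubmonoid.closure I := by
        induction hf using AddSubmonoid.closure_induction with
        | mem f hf => exact h2 x f hf
        | zero => rw [map_zero]; exact zero_mem _
        | add f g _ _ hf hg => rw [map_add]; exact add_mem hf hg
      exact ha _ this
  exact Subtype.ext (VectorFunction.ext fun u => key u f (AddSubmonoid.subset_closure hf))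

theorem field_jacobi (f g k : fieldAlgebra K X) :
    triple f g k + triple g k f + triple k f g = 0 := by
  refine field_eq_zero (I := {a | ∃ f g k : fieldAlgebra K X,
    a = triple f g k + triple g k f + triple k f g}) ?_ ?_ _ ⟨f, g, k, rfl⟩
  · rintro _ ⟨f, g, k, rfl⟩
    simp only [map_add, baseValue_triple, Ring.lie_def]
    noncomm_ring
  · rintro x _ ⟨f, g, k, rfl⟩
    have hD := fieldTranslate_mul (mem_oddPart.1 (ι_mem_oddPart (K := K) x)).1
    have : fieldTranslate (FreeAlgebra.ι K x) (triple f g k + triple g k f + triple k f g) =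
        (triple (fieldTranslate (FreeAlgebra.ι K x) f) g k +
          triple g k (fieldTranslate (FreeAlgebra.ι K x) f) +
          triple k (fieldTranslate (FreeAlgebra.ι K x) f) g) +
        (triple f (fieldTranslate (FreeAlgebra.ι K x) g) k +
          triple (fieldTranslate (FreeAlgebra.ι K x) g) k f +
          triple k f (fieldTranslate (FreeAlgebra.ι K x) g)) +
        (triple f g (fieldTranslate (FreeAlgebra.ι K x) k) +
          triple g (fieldTranslate (FreeAlgebra.ι K x) k) f +
          triple (fieldTranslate (FreeAlgebra.ι K x) k) f g) := by
      simp only [map_add, map_triple_of_derivation hD]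
      abel
    rw [this]
    exact add_mem (add_mem (AddSubmonoid.subset_closure ⟨_, _, _, rfl⟩)
      (AddSubmonoid.subset_closure ⟨_, _, _, rfl⟩)) (AddSubmonoid.subset_closure ⟨_, _, _, rfl⟩)

/-- At the base point multiplication by `w` is translation by w(1), which is a derivation of the
product and hence of the triple bracket. Translating the defect by a letter gives a sum of defects,
so `field_eq_zero` applies. -/
theorem field_derivation (w f g k : fieldAlgebra K X) :
    w * triple f g k - triple (w * f) g k - triple f (w * g) k - triple f g (w * k) = 0 := by
  refine field_eq_zero (I := {a | ∃ w f g k : fieldAlgebra K X, a =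
    w * triple f g k - triple (w * f) g k - triple f (w * g) k - triple f g (w * k)}) ?_ ?_ _
    ⟨w, f, g, k, rfl⟩
  · rintro _ ⟨w, f, g, k, rfl⟩
    have hD := fieldTranslate_mul (mem_oddPart.1 (baseValue_mem w)).1
    simp only [map_sub, baseValue_mul, map_triple_of_derivation hD, baseValue_triple, map_add]
    abel
  · rintro x _ ⟨w, f, g, k, rfl⟩
    have hD := fieldTranslate_mul (mem_oddPart.1 (ι_mem_oddPart (K := K) x)).1
    set D := fieldTranslate (FreeAlgebra.ι K x)
    have h1 : ∀ t t' y z : fieldAlgebra K X, triple (t + t') y z = triple t y z + triple t' y z := by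
      intro t t' y z; simp only [triple, ass, add_mul, mul_add]; abel
    have h2 : ∀ t t' y z : fieldAlgebra K X, triple y (t + t') z = triple y t z + triple y t' z := by
      intro t t' y z; simp only [triple, ass, add_mul, mul_add]; abel
    have h3 : ∀ t t' y z : fieldAlgebra K X, triple y z (t + t') = triple y z t + triple y z t' := by
      intro t t' y z; simp only [triple, ass, mul_add]; abel
    have : D (w * triple f g k - triple (w * f) g k - triple f (w * g) k - triple f g (w * k)) =
        (D w * triple f g k - triple (D w * f) g k - triple f (D w * g) k -
          triple f g (D w * k)) +
        (w * triple (D f) g k - triple (w * D f) g k - triple (D f) (w * g) k -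
          triple (D f) g (w * k)) +
        (w * triple f (D g) k - triple (w * f) (D g) k - triple f (w * D g) k -
          triple f (D g) (w * k)) +
        (w * triple f g (D k) - triple (w * f) g (D k) - triple f (w * g) (D k) -
          triple f g (w * D k)) := by
      simp only [map_sub, map_triple_of_derivation hD, hD, h1, h2, h3, mul_add]
      abel
    rw [this]
    exact add_mem (add_mem (add_mem (AddSubmonoid.subset_closure ⟨_, _, _, _, rfl⟩)
      (AddSubmonoid.subset_closure ⟨_, _, _, _, rfl⟩))
      (AddSubmonoid.subset_closure ⟨_, _, _, _, rfl⟩))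
      (AddSubmonoid.subset_closure ⟨_, _, _, _, rfl⟩)

theorem leibnizSum_congr_map {A B M : Type*} [AddCommGroup M] {f g : A → A} {e : A → B}
    (h : ∀ a, e (f a) = e (g a)) (G : List B → M) (l : List A) :
    leibnizSum f (fun l' => G (l'.map e)) l = leibnizSum g (fun l' => G (l'.map e)) l := by
  induction l generalizing G with
  | nil => rfl
  | cons a l ih =>
    simp only [leibnizSum, List.map_cons, h]
    rw [ih fun l' => G (e a :: l')]

/-- At the base point, words act through the product of their values. -/
theorem baseValue_wordAct (l : List (fieldAlgebra K X)) (r : fieldAlgebra K X) :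
    baseValue (wordAct l r) = r.1 (l.map baseValue).prod := by
  induction hn : l.length generalizing l r with
  | zero =>
    rw [List.length_eq_zero_iff] at hn
    subst hn
    rfl
  | succ n ih =>
    obtain _ | ⟨z, l⟩ := l
    · simp at hn
    have hl : l.length = n := by simpa using hn
    rw [wordAct_cons, map_sub, baseValue_mul,
      derivation_wordAct _ (fieldTranslate_mul (mem_oddPart.1 (baseValue_mem z)).1), map_add,
      map_leibnizSum baseValue, map_leibnizSum baseValue, ih l _ hl,
      leibnizSum_congr fun l' hl' => ih l' r (hl'.trans hl),
      leibnizSum_congr (f := fun a => z * a) fun l' hl' => ih l' r (hl'.trans hl),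
      leibnizSum_congr_map (f := fun a => z * a) (g := fieldTranslate (baseValue z))
        (fun a => baseValue_mul z a) (fun l => r.1 l.prod), add_sub_cancel_left, List.map_cons,
      List.prod_cons]
    rfl

end FieldAlgebra

end LieTriple

end

noncomputable section

namespace LieTriple

open TripleMagma

/-! ### Words under algebra maps and scalings -/

section Words

theorem exists_perm_of_ofFn_perm {A : Type*} {k : ℕ} {b b' : Fin k → A}
    (h : (List.ofFn b).Perm (List.ofFn b')) : ∃ σ : Equiv.Perm (Fin k), b' = b ∘ σ := by
  classical
  let : LinearOrder A := linearOrderOfSTO WellOrderingRel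
  have h1 : b ∘ Tuple.sort b = b' ∘ Tuple.sort b' :=
    List.ofFn_injective <| (((Tuple.sort b).ofFn_comp_perm b).trans
      (h.trans ((Tuple.sort b').ofFn_comp_perm b').symm)).eq_of_pairwise'
        (Tuple.monotone_sort b).sortedLE_ofFn.pairwise (Tuple.monotone_sort b').sortedLE_ofFn.pairwise
  refine ⟨(Tuple.sort b').symm.trans (Tuple.sort b), ?_⟩
  funext i
  have := congrFun h1 ((Tuple.sort b').symm i)
  simpa using this.symm

theorem map_graft {A A' F : Type*} [NonUnitalNonAssocRing A] [NonUnitalNonAssocRing A']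
    [FunLike F A A'] [AddMonoidHomClass F A A'] (φ : F) (hφ : ∀ a b, φ (a * b) = φ a * φ b)
    (k : ℕ) (x : Fin k → A) (r : A) : φ (graft k x r) = graft k (fun i => φ (x i)) (φ r) := by
  induction k with
  | zero => rfl
  | succ k ih =>
    rw [graft, graft, map_sub, hφ, ih, map_sum]
    congr 1
    refine Finset.sum_congr rfl fun i _ => ?_
    rw [ih]
    congr 1
    funext j
    by_cases h : j = i
    · subst h; simp [hφ]
    · simp [Function.update_of_ne h]

theorem graft_smul {K A : Type*} [Field K] [NonUnitalNonAssocRing A] [Module K A]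
    [IsScalarTower K A A] [SMulCommClass K A A] (k : ℕ) (a : Fin k → K) (x : Fin k → A) (c : K)
    (r : A) : graft k (fun i => a i • x i) (c • r) = ((∏ i, a i) * c) • graft k x r := by
  induction k with
  | zero => simp [graft]
  | succ k ih =>
    have h : ∀ i : Fin k, Function.update (fun j : Fin k => a j.succ • x j.succ) i
        ((a 0 • x 0) * (a i.succ • x i.succ)) =
        fun j => Function.update (fun j : Fin k => a j.succ) i (a 0 * a i.succ) j •
          Function.update (fun j : Fin k => x j.succ) i (x 0 * x i.succ) j := by
      intro i
      funext j
      by_cases hj : j = i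
      · subst hj
        simp only [Function.update_self, smul_mul_assoc, mul_smul_comm, mul_smul]
        exact smul_comm _ _ _
      · simp [Function.update_of_ne hj]
    have h2 : ∀ i : Fin k, ∏ j, Function.update (fun j : Fin k => a j.succ) i (a 0 * a i.succ) j =
        a 0 * ∏ j : Fin k, a j.succ := by
      intro i
      rw [Finset.prod_update_of_mem (Finset.mem_univ i), mul_assoc,
        Finset.sdiff_singleton_eq_erase,
        Finset.mul_prod_erase Finset.univ (fun j : Fin k => a j.succ) (Finset.mem_univ i)]
    rw [graft, graft, ih, smul_sub, Finset.smul_sum, Fin.prod_univ_succ]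
    congr 1
    · rw [smul_mul_assoc, mul_smul_comm, smul_smul, mul_assoc]
    · refine Finset.sum_congr rfl fun i _ => ?_
      rw [h, ih, h2]

end Words

/-! ### Symmetrised trees and their weights -/

section SymGraft

variable {K C : Type*} [Field K]

theorem symGraft_eq_of_perm {k l : ℕ} {b : Fin k → Alg K C} {b' : Fin l → Alg K C}
    (h : (List.ofFn b).Perm (List.ofFn b')) (r : Alg K C) : symGraft b r = symGraft b' r := by
  have hkl : k = l := by simpa using h.length_eq
  subst hkl
  obtain ⟨σ, rfl⟩ := exists_perm_of_ofFn_perm h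
  unfold symGraft
  congr 1
  exact (Equiv.sum_comp (Equiv.mulLeft σ) fun τ => graft k (fun i => b (τ i)) r).symm

theorem factorial_smul_symGraft [CharZero K] {k : ℕ} (b : Fin k → Alg K C) (r : Alg K C) :
    (k.factorial : K) • symGraft b r =
      ∑ σ : Equiv.Perm (Fin k), graft k (fun i => b (σ i)) r := by
  rw [symGraft, smul_inv_smul₀ (Nat.cast_ne_zero.2 (Nat.factorial_ne_zero k))]

/-- The symmetrised tree of a multiset of elements. -/
def multisetGraft (m : Multiset (Alg K C)) (r : Alg K C) : Alg K C :=
  symGraft (fun i : Fin m.toList.length => m.toList.get i) r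

theorem multisetGraft_ofFn {k : ℕ} (b : Fin k → Alg K C) (r : Alg K C) :
    multisetGraft (List.ofFn b : Multiset (Alg K C)) r = symGraft b r := by
  refine symGraft_eq_of_perm ?_ r
  rw [List.ofFn_get, ← Multiset.coe_eq_coe, Multiset.coe_toList]

/-- The automorphism of `Alg(C)` which doubles the colours. -/
def doubling (K C : Type*) [Field K] : Alg K C →ₙₐ[K] Alg K C :=
  FreeNonUnitalNonAssocAlgebra.lift K fun c => (2 : K) • colour K c

theorem doubling_colour (c : C) : doubling K C (colour K c) = (2 : K) • colour K c :=
  FreeNonUnitalNonAssocAlgebra.lift_of_apply K _ c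

/-- Every summand contains each `b i` once and the colour once, so weights add and the root
contributes 1. -/
theorem doubling_symGraft {k : ℕ} {b : Fin k → Alg K C} {n : Fin k → ℕ}
    (hb : ∀ i, doubling K C (b i) = (2 : K) ^ n i • b i) (c : C) :
    doubling K C (symGraft b (colour K c)) =
      (2 : K) ^ (∑ i, n i + 1) • symGraft b (colour K c) := by
  rw [symGraft, map_smul, map_sum, smul_comm]
  congr 1
  rw [Finset.smul_sum]
  refine Finset.sum_congr rfl fun σ _ => ?_
  rw [map_graft (doubling K C) (map_mul _)]
  simp only [hb, doubling_colour]
  rw [graft_smul, Equiv.prod_comp σ fun i => (2 : K) ^ n i, Finset.prod_pow_eq_pow_sum, ← pow_succ]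

theorem doubling_triple {x y z : Alg K C} {n m l : ℕ} (hx : doubling K C x = (2 : K) ^ n • x)
    (hy : doubling K C y = (2 : K) ^ m • y) (hz : doubling K C z = (2 : K) ^ l • z) :
    doubling K C (triple x y z) = (2 : K) ^ (n + m + l) • triple x y z := by
  simp only [triple, ass, map_sub, map_mul, hx, hy, hz, smul_mul_assoc, mul_smul_comm, pow_add]
  module

end SymGraft

end LieTriple

end

noncomputable section

namespace LieTriple

open TripleMagma

/-! ### Models separating Hall brackets and trees -/

section Model

variable {K C : Type*} [Field K] [LinearOrder (TripleMagma (Alg K C))]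

omit [LinearOrder (TripleMagma (Alg K C))] in
theorem symTrees_mono {B B' : Set (Alg K C)} (h : B ⊆ B') : symTrees B ⊆ symTrees B' := by
  rintro _ ⟨k, b, c, hb, rfl⟩
  exact ⟨k, b, c, fun i => h (hb i), rfl⟩

variable (K C) in
/-- The map which sends `B` to the Hall triple brackets in the symmetrised trees of `B`. -/
def hallStep : Set (Alg K C) →o Set (Alg K C) where
  toFun B := eval '' hallSet (symTrees B)
  monotone' _ _ h := Set.image_mono fun _ ht => isHall_mono (symTrees_mono h) ht

variable (K C) in
/-- The smallest set of elements of `Alg(C)` which is the Hall triple set of its symmetrised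
trees. -/
def hallTriples : Set (Alg K C) := (hallStep K C).lfp

theorem image_hallSet_hallTriples :
    eval '' hallSet (symTrees (hallTriples K C)) = hallTriples K C :=
  (hallStep K C).map_lfp

/-- The induction principle of the least fixed point: closure under forming trees and Hall brackets
suffices. -/
theorem hallTriples_subset {G : Set (Alg K C)}
    (h : ∀ t, IsHall (symTrees G) t → eval t ∈ G) : hallTriples K C ⊆ G :=
  (hallStep K C).lfp_le (by rintro _ ⟨t, ht, rfl⟩; exact h t ht)

theorem eval_mem_hallTriples {t : TripleMagma (Alg K C)}
    (ht : IsHall (symTrees (hallTriples K C)) t) : eval t ∈ hallTriples K C :=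
  image_hallSet_hallTriples (K := K) (C := C) ▸ Set.mem_image_of_mem eval ht

theorem symGraft_mem_hallTriples {k : ℕ} {b : Fin k → Alg K C} (hb : ∀ i, b i ∈ hallTriples K C)
    (c : C) : symGraft b (colour K c) ∈ hallTriples K C :=
  eval_mem_hallTriples (.leaf ⟨k, b, c, hb, rfl⟩)

theorem isLeast_hallTriples :
    IsLeast {B' : Set (Alg K C) | B' = eval '' hallSet (symTrees B')} (hallTriples K C) :=
  ⟨image_hallSet_hallTriples.symm, fun _ h => (hallStep K C).lfp_le h.ge⟩

theorem map_triple {A A' F : Type*} [NonUnitalNonAssocRing A] [NonUnitalNonAssocRing A']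
    [FunLike F A A'] [AddMonoidHomClass F A A'] (φ : F) (hφ : ∀ a b, φ (a * b) = φ a * φ b)
    (x y z : A) : φ (triple x y z) = triple (φ x) (φ y) (φ z) := by
  simp only [triple, ass, map_sub, hφ]

omit [LinearOrder (TripleMagma (Alg K C))] in
theorem map_eq_zero_of_mem_latIdeal {X : Type*} (Φ : Alg K C →ₙₐ[K] fieldAlgebra K X) {a : Alg K C}
    (ha : a ∈ latIdeal K C) : Φ a = 0 := by
  have h : latIdeal K C ≤ LinearMap.ker (Φ : Alg K C →ₗ[K] fieldAlgebra K X) := by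
    refine sInf_le ⟨?_, fun a x hx => ?_⟩
    · rintro _ (⟨x, y, z, rfl⟩ | ⟨w, x, y, z, rfl⟩)
      · change Φ _ = 0
        simp only [map_add, map_triple Φ (map_mul Φ)]
        exact field_jacobi _ _ _
      · change Φ _ = 0
        simp only [map_sub, map_mul, map_triple Φ (map_mul Φ)]
        exact field_derivation _ _ _ _
    · change Φ x = 0 at hx
      exact ⟨by change Φ _ = 0; rw [map_mul, hx, mul_zero],
        by change Φ _ = 0; rw [map_mul, hx, zero_mul]⟩
  exact h ha

variable [CharZero K] {ω : Alg K C → ℕ} (hω : ∀ s, 0 < ω s)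
  (hlt : ∀ u v : TripleMagma (Alg K C), u.grade ω < v.grade ω → u < v)

include hω hlt

/-- There are algebras of vector fields over `Alg(C)` in which the symmetrised trees take
prescribed values at the base point. -/
theorem exists_model (ℓ : Multiset (Alg K C) → C → FreeAlgebra K (Alg K C))
    (hℓ : ∀ m c, ℓ m c ∈ oddPart K (Alg K C)) :
    ∃ Φ : Alg K C →ₙₐ[K] fieldAlgebra K (Alg K C),
      ∀ (k : ℕ) (h : Fin k → TripleMagma (Alg K C)) (b : Fin k → Alg K C) (c : C),
        (∀ i, IsHall Set.univ (h i)) → (∀ i, baseValue (Φ (b i)) = hallPoly K (h i)) →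
        baseValue (Φ (symGraft b (colour K c))) = ℓ (List.ofFn fun i => eval (h i)) c := by
  classical
  have := fun c : C => exists_isField (K := K) (X := Alg K C)
    (e := fun t : {t : TripleMagma (Alg K C) // IsHall Set.univ t} => hallPoly K t.1)
    (fun t => hallPoly_mem_oddPart t.1) (linearIndependent_hallPoly hω hlt)
    (fun α => ℓ (α.map fun t => eval t.1) c) (fun α => hℓ _ _)
  choose f hf hΛ using this
  refine ⟨FreeNonUnitalNonAssocAlgebra.lift K
    fun c => (⟨f c, hf c⟩ : fieldAlgebra K (Alg K C)), ?_⟩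
  intro k h b c hh hb
  set Φ := FreeNonUnitalNonAssocAlgebra.lift K
    fun c => (⟨f c, hf c⟩ : fieldAlgebra K (Alg K C)) with hΦ
  have hc : Φ (colour K c) = ⟨f c, hf c⟩ := FreeNonUnitalNonAssocAlgebra.lift_of_apply K _ c
  have hk : (k.factorial : K) ≠ 0 := Nat.cast_ne_zero.2 (Nat.factorial_ne_zero k)
  refine smul_right_injective _ hk ?_
  have hσ : ∀ σ : Equiv.Perm (Fin k), baseValue (Φ (graft k (fun i => b (σ i)) (colour K c))) =
      f c (List.ofFn fun i => hallPoly K (h (σ i))).prod := by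
    intro σ
    rw [map_graft Φ (map_mul Φ), graft_eq_wordAct, baseValue_wordAct, hc, List.map_ofFn]
    simp only [Function.comp_def, hb]
    rfl
  dsimp only
  rw [← map_smul, ← map_smul, factorial_smul_symGraft, map_sum, map_sum]
  simp only [hσ]
  -- The sum over the orderings is k! times a symmetrised product of Hall polynomials, where `f c`
  -- has the prescribed value.
  rw [← map_sum, sum_perm_prod (K := K)
    (fun t : {t : TripleMagma (Alg K C) // IsHall Set.univ t} => hallPoly K t.1)
    (fun i => ⟨h i, hh i⟩), map_smul, hΛ]
  simp [List.map_ofFn, Function.comp_def]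

omit [CharZero K] hω hlt in
theorem baseValue_eval {Φ : Alg K C →ₙₐ[K] fieldAlgebra K (Alg K C)} {S : Set (Alg K C)}
    (hΦ : ∀ s ∈ S, baseValue (Φ s) = FreeAlgebra.ι K s) {t : TripleMagma (Alg K C)}
    (ht : IsHall S t) : baseValue (Φ (eval t)) = hallPoly K t := by
  induction ht with
  | leaf hs => exact hΦ _ hs
  | bracket _ _ _ _ _ _ h1 h2 h3 =>
    rw [eval, map_triple Φ (map_mul Φ), baseValue_triple, h1, h2, h3, hallPoly]

/-- There is an algebra of vector fields in which the Hall triple brackets take the values of the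
Hall basis of the free Lie triple system at the base point. -/
theorem exists_hall_model : ∃ Φ : Alg K C →ₙₐ[K] fieldAlgebra K (Alg K C),
    ∀ t, IsHall (symTrees (hallTriples K C)) t → baseValue (Φ (eval t)) = hallPoly K t := by
  obtain ⟨Φ, hΦ⟩ := exists_model hω hlt
    -- Each tree is given as base value the letter which is the tree itself.
    (fun m c => FreeAlgebra.ι K (multisetGraft m (colour K c))) fun m c => ι_mem_oddPart _
  -- `exists_model` needs a formal Hall tree for each leaf, so the induction records one, over
  -- arbitrary letters.
  let G : Set (Alg K C) :=
    {b | ∃ t, IsHall Set.univ t ∧ eval t = b ∧ baseValue (Φ b) = hallPoly K t}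
  have hS : ∀ s ∈ symTrees G, baseValue (Φ s) = FreeAlgebra.ι K s := by
    rintro _ ⟨k, b, c, hb, rfl⟩
    choose t h1 h2 h3 using hb
    rw [hΦ k t b c h1 h3]
    simp only [h2, multisetGraft_ofFn]
  have hG : hallTriples K C ⊆ G := hallTriples_subset fun t ht =>
    ⟨t, isHall_mono (Set.subset_univ _) ht, rfl, baseValue_eval hS ht⟩
  exact ⟨Φ, fun t ht => baseValue_eval (fun s hs => hS s (symTrees_mono hG hs)) ht⟩

theorem injOn_eval : Set.InjOn eval (hallSet (symTrees (hallTriples K C))) := by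
  obtain ⟨Φ, hΦ⟩ := exists_hall_model hω hlt
  intro t ht t' ht' h
  have h1 : hallPoly K t = hallPoly K t' := by rw [← hΦ t ht, ← hΦ t' ht', h]
  exact congrArg Subtype.val ((linearIndependent_hallPoly (K := K) hω hlt).injective
    (a₁ := ⟨t, isHall_mono (Set.subset_univ _) ht⟩)
    (a₂ := ⟨t', isHall_mono (Set.subset_univ _) ht'⟩) h1)

theorem linearIndependent_hallTriples :
    LinearIndependent K fun x : hallTriples K C => (latIdeal K C).mkQ (x : Alg K C) := by
  obtain ⟨Φ, hΦ⟩ := exists_hall_model hω hlt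
  have hex : ∀ x : hallTriples K C, ∃ t, IsHall (symTrees (hallTriples K C)) t ∧ eval t = x := by
    rintro ⟨x, hx⟩
    rw [← image_hallSet_hallTriples] at hx
    exact hx
  choose t ht htx using hex
  let L : LAT K C →ₗ[K] FreeAlgebra K (Alg K C) :=
    (latIdeal K C).liftQ (baseValue.comp (Φ : Alg K C →ₗ[K] fieldAlgebra K (Alg K C)))
      fun a ha => by
        change baseValue (Φ a) = 0
        rw [map_eq_zero_of_mem_latIdeal Φ ha, map_zero]
  refine LinearIndependent.of_comp L ?_
  have h : L ∘ (fun x : hallTriples K C => (latIdeal K C).mkQ (x : Alg K C)) =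
      (fun t : {t : TripleMagma (Alg K C) // IsHall Set.univ t} => hallPoly K t.1) ∘
        fun x => ⟨t x, isHall_mono (Set.subset_univ _) (ht x)⟩ := by
    funext x
    change baseValue (Φ x) = hallPoly K (t x)
    rw [← hΦ (t x) (ht x), htx]
  rw [h]
  refine (linearIndependent_hallPoly hω hlt).comp _ fun x y hxy => Subtype.ext ?_
  rw [← htx x, ← htx y]
  exact congrArg (fun t => eval t.1) hxy

theorem ne_zero_of_mem_hallTriples {x : Alg K C} (hx : x ∈ hallTriples K C) : x ≠ 0 := by
  rintro rfl
  exact (linearIndependent_hallTriples hω hlt).ne_zero (⟨0, hx⟩ : hallTriples K C) (map_zero _)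

omit [LinearOrder (TripleMagma (Alg K C))] hω hlt in
theorem weight_unique {x : Alg K C} (hx : x ≠ 0) {n m : ℕ}
    (hn : doubling K C x = (2 : K) ^ n • x) (hm : doubling K C x = (2 : K) ^ m • x) : n = m := by
  have h := smul_left_injective K hx (hn.symm.trans hm)
  exact Nat.pow_right_injective le_rfl (by exact_mod_cast h)

omit [CharZero K] hω hlt in
theorem exists_weight {x : Alg K C} (hx : x ∈ hallTriples K C) :
    ∃ n : ℕ, doubling K C x = (2 : K) ^ n • x := by
  refine hallTriples_subset (G := {x | ∃ n : ℕ, doubling K C x = (2 : K) ^ n • x})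
    (fun t ht => ?_) hx
  induction ht with
  | leaf hs =>
    obtain ⟨k, b, c, hb, rfl⟩ := hs
    choose n hn using hb
    exact ⟨_, doubling_symGraft hn c⟩
  | bracket _ _ _ _ _ _ h1 h2 h3 =>
    obtain ⟨n, hn⟩ := h1
    obtain ⟨m, hm⟩ := h2
    obtain ⟨l, hl⟩ := h3
    exact ⟨_, doubling_triple hn hm hl⟩

/-- The model is altered by giving the tree with root `c` and leaves `b` the value 0. All elements
of smaller weight keep their values, among them the leaves of both trees, so a tree with other data
would have a letter as value, which is not 0. -/
theorem symGraft_injective {k l : ℕ} {b : Fin k → Alg K C} {b' : Fin l → Alg K C} {c c' : C}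
    (hb : ∀ i, b i ∈ hallTriples K C) (hb' : ∀ i, b' i ∈ hallTriples K C)
    (h : symGraft b (colour K c) = symGraft b' (colour K c')) :
    c = c' ∧ (List.ofFn b).Perm (List.ofFn b') := by
  classical
  by_contra hne
  choose n hn using fun i => exists_weight (hb i)
  choose n' hn' using fun i => exists_weight (hb' i)
  have hs0 := ne_zero_of_mem_hallTriples hω hlt (symGraft_mem_hallTriples hb c)
  have hN := doubling_symGraft hn c
  have hN' := doubling_symGraft hn' c'
  rw [← h] at hN'
  have hNN := weight_unique hs0 hN hN'
  set N := ∑ i, n i + 1 with hNdef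
  obtain ⟨Φ, hΦ⟩ := exists_model hω hlt
    (fun m d => if d = c ∧ m = (List.ofFn b : Multiset (Alg K C)) then 0 else
      FreeAlgebra.ι K (multisetGraft m (colour K d))) fun m d => by
        split_ifs
        exacts [zero_mem _, ι_mem_oddPart _]
  let G : Set (Alg K C) := {x | x ∈ hallTriples K C ∧
    ∀ n : ℕ, doubling K C x = (2 : K) ^ n • x → n < N →
      ∃ t, IsHall Set.univ t ∧ eval t = x ∧ baseValue (Φ x) = hallPoly K t}
  have hGB : symTrees G ⊆ symTrees (hallTriples K C) := symTrees_mono fun x hx => hx.1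
  have hG : hallTriples K C ⊆ G := by
    refine hallTriples_subset fun t ht => ⟨eval_mem_hallTriples (isHall_mono hGB ht),
      fun n hn hnN => ⟨t, isHall_mono (Set.subset_univ _) ht, rfl, ?_⟩⟩
    induction ht generalizing n with
    | @leaf s hs =>
      obtain ⟨k₁, b₁, d, hb₁, rfl⟩ := hs
      choose m hm using fun i => exists_weight (hb₁ i).1
      have hs1 := symGraft_mem_hallTriples (fun i => (hb₁ i).1) d
      have hw := weight_unique (ne_zero_of_mem_hallTriples hω hlt hs1) hn (doubling_symGraft hm d)
      have hmN : ∀ i, m i < N := fun i => by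
        have := Finset.single_le_sum (f := m) (fun _ _ => Nat.zero_le _) (Finset.mem_univ i)
        omega
      choose t h1 h2 h3 using fun i => (hb₁ i).2 (m i) (hm i) (hmN i)
      rw [eval, hΦ k₁ t b₁ d h1 h3]
      simp only [h2, multisetGraft_ofFn]
      rw [if_neg, hallPoly]
      rintro ⟨rfl, hp⟩
      have hp' : symGraft b₁ (colour K d) = symGraft b (colour K d) :=
        symGraft_eq_of_perm (Multiset.coe_eq_coe.1 hp) _
      rw [eval, hp'] at hn
      -- The altered tree has weight N, so it cannot occur below that weight.
      exact hnN.ne (weight_unique hs0 hn hN)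
    | @bracket u v w hu hv hw h1 h2 h3 ihu ihv ihw =>
      have mem : ∀ {t}, IsHall (symTrees G) t → eval t ∈ hallTriples K C := fun ht =>
        eval_mem_hallTriples (isHall_mono hGB ht)
      obtain ⟨n₁, hn₁⟩ := exists_weight (mem hu)
      obtain ⟨n₂, hn₂⟩ := exists_weight (mem hv)
      obtain ⟨n₃, hn₃⟩ := exists_weight (mem hw)
      have := weight_unique (ne_zero_of_mem_hallTriples hω hlt
        (mem (.bracket hu hv hw h1 h2 h3))) hn (doubling_triple hn₁ hn₂ hn₃)
      rw [eval, map_triple Φ (map_mul Φ), baseValue_triple, ihu n₁ hn₁ (by omega),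
        ihv n₂ hn₂ (by omega), ihw n₃ hn₃ (by omega), hallPoly]
  have lt_N : ∀ i, n i < N := fun i => by
    have := Finset.single_le_sum (f := n) (fun _ _ => Nat.zero_le _) (Finset.mem_univ i)
    omega
  have lt_N' : ∀ i, n' i < N := fun i => by
    have := Finset.single_le_sum (f := n') (fun _ _ => Nat.zero_le _) (Finset.mem_univ i)
    omega
  choose t h1 h2 h3 using fun i => (hG (hb i)).2 (n i) (hn i) (lt_N i)
  choose t' h1' h2' h3' using fun i => (hG (hb' i)).2 (n' i) (hn' i) (lt_N' i)
  have e1 := hΦ k t b c h1 h3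
  have e2 := hΦ l t' b' c' h1' h3'
  simp only [h2, h2', true_and, if_true] at e1 e2
  rw [if_neg, ← h, e1] at e2
  · exact FreeAlgebra.ι_ne_zero _ e2.symm
  · rintro ⟨hc, hp⟩
    exact hne ⟨hc.symm, (Multiset.coe_eq_coe.1 hp).symm⟩

end Model

end LieTriple

end

noncomputable section

namespace LieTriple

open TripleMagma

/-! ### The identities in the quotient -/

section Quotient

variable {K C : Type*} [Field K]

theorem mkQ_mul (a b : Alg K C) :
    (latIdeal K C).mkQ (a * b) = (latIdeal K C).mkQ a * (latIdeal K C).mkQ b := rfl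

instance latRing : NonUnitalNonAssocRing (LAT K C) :=
  { (inferInstance : AddCommGroup (LAT K C)), latMul K C with
    left_distrib := by
      intro a b c
      obtain ⟨a, rfl⟩ := (latIdeal K C).mkQ_surjective a
      obtain ⟨b, rfl⟩ := (latIdeal K C).mkQ_surjective b
      obtain ⟨c, rfl⟩ := (latIdeal K C).mkQ_surjective c
      exact congrArg (latIdeal K C).mkQ (mul_add a b c)
    right_distrib := by
      intro a b c
      obtain ⟨a, rfl⟩ := (latIdeal K C).mkQ_surjective a
      obtain ⟨b, rfl⟩ := (latIdeal K C).mkQ_surjective b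
      obtain ⟨c, rfl⟩ := (latIdeal K C).mkQ_surjective c
      exact congrArg (latIdeal K C).mkQ (add_mul a b c)
    zero_mul := by
      intro a
      obtain ⟨a, rfl⟩ := (latIdeal K C).mkQ_surjective a
      exact congrArg (latIdeal K C).mkQ (zero_mul a)
    mul_zero := by
      intro a
      obtain ⟨a, rfl⟩ := (latIdeal K C).mkQ_surjective a
      exact congrArg (latIdeal K C).mkQ (mul_zero a) }

instance : IsScalarTower K (LAT K C) (LAT K C) where
  smul_assoc r a b := by
    obtain ⟨a, rfl⟩ := (latIdeal K C).mkQ_surjective a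
    obtain ⟨b, rfl⟩ := (latIdeal K C).mkQ_surjective b
    exact congrArg (latIdeal K C).mkQ (smul_mul_assoc r a b)

instance : SMulCommClass K (LAT K C) (LAT K C) where
  smul_comm r a b := by
    obtain ⟨a, rfl⟩ := (latIdeal K C).mkQ_surjective a
    obtain ⟨b, rfl⟩ := (latIdeal K C).mkQ_surjective b
    exact congrArg (latIdeal K C).mkQ (mul_smul_comm r a b).symm

theorem latRelations_subset_latIdeal : latRelations K C ⊆ latIdeal K C := fun a ha => by
  rw [latIdeal, SetLike.mem_coe, Submodule.mem_sInf]
  exact fun J hJ => hJ.1 ha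

theorem mkQ_triple (x y z : Alg K C) : (latIdeal K C).mkQ (triple x y z) =
    triple ((latIdeal K C).mkQ x) ((latIdeal K C).mkQ y) ((latIdeal K C).mkQ z) :=
  map_triple _ mkQ_mul x y z

theorem lat_jacobi (x y z : LAT K C) : triple x y z + triple y z x + triple z x y = 0 := by
  obtain ⟨x, rfl⟩ := (latIdeal K C).mkQ_surjective x
  obtain ⟨y, rfl⟩ := (latIdeal K C).mkQ_surjective y
  obtain ⟨z, rfl⟩ := (latIdeal K C).mkQ_surjective z
  simp only [← mkQ_triple, ← map_add]
  exact (Submodule.Quotient.mk_eq_zero _).2 (latRelations_subset_latIdeal (Or.inl ⟨x, y, z, rfl⟩))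

theorem lat_derivation (w x y z : LAT K C) :
    w * triple x y z = triple (w * x) y z + triple x (w * y) z + triple x y (w * z) := by
  obtain ⟨w, rfl⟩ := (latIdeal K C).mkQ_surjective w
  obtain ⟨x, rfl⟩ := (latIdeal K C).mkQ_surjective x
  obtain ⟨y, rfl⟩ := (latIdeal K C).mkQ_surjective y
  obtain ⟨z, rfl⟩ := (latIdeal K C).mkQ_surjective z
  rw [← sub_eq_zero, ← sub_sub, ← sub_sub]
  simp only [← mkQ_mul, ← mkQ_triple, ← map_sub]
  exact (Submodule.Quotient.mk_eq_zero _).2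
    (latRelations_subset_latIdeal (Or.inr ⟨w, x, y, z, rfl⟩))

theorem evalWith_mkQ (t : TripleMagma (Alg K C)) :
    evalWith (latIdeal K C).mkQ t = (latIdeal K C).mkQ (eval t) := by
  induction t with
  | leaf x => rfl
  | bracket u v w hu hv hw => rw [evalWith, eval, mkQ_triple, hu, hv, hw]

end Quotient

theorem triple_mem_span {K A : Type*} [Field K] [NonUnitalNonAssocRing A] [Module K A]
    [IsScalarTower K A A] [SMulCommClass K A A] {T : Set A}
    (h : ∀ x ∈ T, ∀ y ∈ T, ∀ z ∈ T, triple x y z ∈ Submodule.span K T) :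
    ∀ x ∈ Submodule.span K T, ∀ y ∈ Submodule.span K T, ∀ z ∈ Submodule.span K T,
      triple x y z ∈ Submodule.span K T := by
  have h1 : ∀ x ∈ T, ∀ y ∈ T,
      Submodule.span K T ≤ (Submodule.span K T).comap (tripleRight K x y) := fun x hx y hy =>
    Submodule.span_le.2 (h x hx y hy)
  have h2 : ∀ x ∈ T, ∀ z ∈ Submodule.span K T,
      Submodule.span K T ≤ (Submodule.span K T).comap (tripleMid K x z) := fun x hx z hz =>
    Submodule.span_le.2 fun y hy => h1 x hx y hy hz
  have h3 : ∀ y ∈ Submodule.span K T, ∀ z ∈ Submodule.span K T,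
      Submodule.span K T ≤ (Submodule.span K T).comap (tripleMid K y z) := fun y hy z hz =>
    Submodule.span_le.2 fun x hx => by
      change triple y x z ∈ Submodule.span K T
      rw [triple_swap]
      exact neg_mem (h2 x hx z hz hy)
  intro x hx y hy z hz
  rw [triple_swap]
  exact neg_mem (h3 y hy z hz hx)

/-! ### The Hall brackets span -/

section Spanning

variable {K C : Type*} [Field K] [CharZero K] [LinearOrder (TripleMagma (Alg K C))]
  {ω : Alg K C → ℕ} (hω : ∀ s, 0 < ω s)
  (hlt : ∀ u v : TripleMagma (Alg K C), u.grade ω < v.grade ω → u < v)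

variable (K C) in
/-- The subspace of `LAT(C)` spanned by the Hall triple brackets. -/
def hallSubspace : Submodule K (LAT K C) :=
  Submodule.span K ((latIdeal K C).mkQ '' hallTriples K C)

omit [CharZero K] in
theorem mkQ_mem_hallSubspace {x : Alg K C} (hx : x ∈ hallTriples K C) :
    (latIdeal K C).mkQ x ∈ hallSubspace K C :=
  Submodule.subset_span ⟨x, hx, rfl⟩

omit [CharZero K] in
include hω hlt in
theorem triple_mem_hallSubspace : ∀ x ∈ hallSubspace K C, ∀ y ∈ hallSubspace K C,
    ∀ z ∈ hallSubspace K C, triple x y z ∈ hallSubspace K C := by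
  have himage : (latIdeal K C).mkQ '' hallTriples K C =
      evalWith (latIdeal K C).mkQ '' {t | IsHall (symTrees (hallTriples K C)) t} := by
    conv_lhs => rw [← image_hallSet_hallTriples]
    rw [Set.image_image]
    simp only [evalWith_mkQ]
    rfl
  rw [hallSubspace, himage]
  refine triple_mem_span ?_
  rintro _ ⟨p, hp, rfl⟩ _ ⟨q, hq, rfl⟩ _ ⟨w, hw, rfl⟩
  exact triple_mem_span_isHall hω hlt lat_derivation lat_jacobi _ hp hq hw

include hω hlt

theorem wordAct_mem_hallSubspace (c : C) (l : List (LAT K C)) (hl : ∀ a ∈ l, a ∈ hallSubspace K C) :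
    wordAct l ((latIdeal K C).mkQ (colour K c)) ∈ hallSubspace K C := by
  refine wordAct_mem (K := K) (triple_mem_hallSubspace hω hlt) lat_derivation
    (T := (latIdeal K C).mkQ '' hallTriples K C) rfl (fun k b hb => ?_) l hl
  choose b' hb' hbb using hb
  obtain rfl : (fun i => (latIdeal K C).mkQ (b' i)) = b := funext hbb
  have h : ∑ σ : Equiv.Perm (Fin k), graft k (fun i => (latIdeal K C).mkQ (b' (σ i)))
      ((latIdeal K C).mkQ (colour K c)) =
      (k.factorial : K) • (latIdeal K C).mkQ (symGraft b' (colour K c)) := by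
    rw [← map_smul, factorial_smul_symGraft, map_sum]
    exact Finset.sum_congr rfl fun σ _ => (map_graft _ mkQ_mul _ _ _).symm
  rw [h]
  exact Submodule.smul_mem _ _ (mkQ_mem_hallSubspace (symGraft_mem_hallTriples hb' c))

/-- Induction on the generation of `hallTriples` in the right factor: brackets follow from the
derivation rule, trees from the recursion for words. -/
theorem mul_mem_hallSubspace {w z : LAT K C} (hw : w ∈ hallSubspace K C)
    (hz : z ∈ hallSubspace K C) : w * z ∈ hallSubspace K C := by
  have htriple := triple_mem_hallSubspace hω hlt
  let G : Set (Alg K C) := {x | x ∈ hallTriples K C ∧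
    ∀ w ∈ hallSubspace K C, w * (latIdeal K C).mkQ x ∈ hallSubspace K C}
  have hGB : symTrees G ⊆ symTrees (hallTriples K C) := symTrees_mono fun x hx => hx.1
  have hG : hallTriples K C ⊆ G := by
    refine hallTriples_subset fun t ht => ?_
    induction ht with
    | @leaf s hs =>
      refine ⟨eval_mem_hallTriples (.leaf (hGB hs)), fun w hw => ?_⟩
      obtain ⟨k, b, c, hb, rfl⟩ := hs
      rw [eval, symGraft, map_smul, map_sum, mul_smul_comm, Finset.mul_sum]
      refine Submodule.smul_mem _ _ (sum_mem fun σ _ => ?_)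
      rw [map_graft _ mkQ_mul, graft_eq_wordAct]
      set l := List.ofFn fun i => (latIdeal K C).mkQ (b (σ i)) with hl
      have hlW : ∀ a ∈ l, a ∈ hallSubspace K C ∧ w * a ∈ hallSubspace K C := by
        intro a ha
        rw [hl, List.mem_ofFn] at ha
        obtain ⟨i, rfl⟩ := ha
        exact ⟨mkQ_mem_hallSubspace (hb _).1, (hb _).2 w hw⟩
      have h1 : ∀ a ∈ l, a ∈ hallSubspace K C := fun a ha => (hlW a ha).1
      have h2 := wordAct_cons w l ((latIdeal K C).mkQ (colour K c))
      -- The product is the longer word w · l acting on the colour, plus words in which one letter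
      -- `a` is replaced by w * a, known to lie in the subspace by induction.
      rw [← sub_add_cancel (w * wordAct l _), ← h2]
      refine add_mem (wordAct_mem_hallSubspace hω hlt c _ ?_) ?_
      · simpa [hw] using h1
      · exact leibnizSum_mem _ (fun a ha => (hlW a ha).2) h1
          fun l' _ hl' => wordAct_mem_hallSubspace hω hlt c l' hl'
    | bracket hu hv hw' h1 h2 h3 ihu ihv ihw =>
      refine ⟨eval_mem_hallTriples (isHall_mono hGB (.bracket hu hv hw' h1 h2 h3)),
        fun w hw => ?_⟩
      rw [eval, mkQ_triple, lat_derivation]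
      have hu' := mkQ_mem_hallSubspace ihu.1
      have hv' := mkQ_mem_hallSubspace ihv.1
      have hw' := mkQ_mem_hallSubspace ihw.1
      exact add_mem (add_mem (htriple _ (ihu.2 w hw) _ hv' _ hw')
        (htriple _ hu' _ (ihv.2 w hw) _ hw')) (htriple _ hu' _ hv' _ (ihw.2 w hw))
  have h : hallSubspace K C ≤ (hallSubspace K C).comap (LinearMap.mulLeft K w) := by
    refine Submodule.span_le.2 ?_
    rintro _ ⟨x, hx, rfl⟩
    exact (hG hx).2 w hw
  exact h hz

/-- The preimage in `Alg(C)` is a subalgebra containing the colours, which are the symmetrised trees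
with k = 0. -/
theorem hallSubspace_eq_top : hallSubspace K C = ⊤ := by
  let N : NonUnitalSubalgebra K (Alg K C) :=
    { (hallSubspace K C).comap (latIdeal K C).mkQ with
      mul_mem' := fun {a b} ha hb => mul_mem_hallSubspace hω hlt ha hb }
  have hcol : ∀ c : C, colour K c ∈ N := fun c => by
    have h : symGraft (Fin.elim0 : Fin 0 → Alg K C) (colour K c) = colour K c := by
      simp [symGraft, graft]
    exact mkQ_mem_hallSubspace (h ▸ symGraft_mem_hallTriples (fun i => i.elim0) c)
  let φ : Alg K C →ₙₐ[K] N :=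
    FreeNonUnitalNonAssocAlgebra.lift K fun c => (⟨colour K c, hcol c⟩ : N)
  have hφ : (NonUnitalSubalgebraClass.subtype N).comp φ = NonUnitalAlgHom.id K (Alg K C) := by
    refine FreeNonUnitalNonAssocAlgebra.hom_ext K fun c => ?_
    change ((φ (colour K c) : N) : Alg K C) = colour K c
    rw [FreeNonUnitalNonAssocAlgebra.lift_of_apply]
  rw [eq_top_iff]
  intro x _
  obtain ⟨a, rfl⟩ := (latIdeal K C).mkQ_surjective x
  have h := (φ a).2
  rwa [show ((φ a : N) : Alg K C) = a from DFunLike.congr_fun hφ a] at h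

end Spanning

end LieTriple

end

/-- The order on formal triple brackets is arbitrary apart from being compatible with a grading;
`ω = 1` is the grading by the number of letters. -/
theorem theorem3p4 (K : Type*) [Field K] [CharZero K] (C : Type*)
    [LinearOrder (LieTriple.TripleMagma (LieTriple.Alg K C))]
    (ω : LieTriple.Alg K C → ℕ) (hω : ∀ s, 0 < ω s)
    (hlt : ∀ u v : LieTriple.TripleMagma (LieTriple.Alg K C), u.grade ω < v.grade ω → u < v) :
    ∃ B : Set (LieTriple.Alg K C),
      -- `B` is the smallest set with `B = H(S)`, `S` the symmetrised trees of elements of `B`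
      IsLeast {B' : Set (LieTriple.Alg K C) |
        B' = LieTriple.TripleMagma.eval '' LieTriple.hallSet (LieTriple.symTrees B')} B ∧
      -- the classes of the elements of `B` form a basis of `LAT(C)`
      (∃ e : Module.Basis B K (LieTriple.LAT K C),
        ∀ x : B, e x = (LieTriple.latIdeal K C).mkQ (x : LieTriple.Alg K C)) ∧
      -- distinct Hall triple brackets are distinct elements of `B`
      Set.InjOn LieTriple.TripleMagma.eval (LieTriple.hallSet (LieTriple.symTrees B)) ∧
      -- distinct non-planar trees are distinct elements of `S`
      (∀ (k l : ℕ) (b : Fin k → LieTriple.Alg K C) (b' : Fin l → LieTriple.Alg K C) (c c' : C),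
        (∀ i, b i ∈ B) → (∀ i, b' i ∈ B) →
        LieTriple.symGraft b (LieTriple.colour K c) =
          LieTriple.symGraft b' (LieTriple.colour K c') →
        c = c' ∧ (List.ofFn b).Perm (List.ofFn b')) := by
  refine ⟨LieTriple.hallTriples K C, LieTriple.isLeast_hallTriples,
    ⟨Module.Basis.mk (LieTriple.linearIndependent_hallTriples hω hlt) ?_, fun x => ?_⟩,
    LieTriple.injOn_eval hω hlt,
    fun _ _ _ _ _ _ hb hb' h => LieTriple.symGraft_injective hω hlt hb hb' h⟩
  · rw [← LieTriple.hallSubspace_eq_top hω hlt, LieTriple.hallSubspace, Set.image_eq_range]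
  · exact Module.Basis.mk_apply _ _ x
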